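/- **Setting.** Let $Z$ be a measurable space and $\mathcal D$ a probability distribution on $Z$. For probability measures $P,Q$ on a common space let $\mathrm{Test}(P;Q)(\alpha)=\inf\{1-\int\varphi\,dQ\}$, $\alpha\in[0,1]$, the infimum over all measurable (randomized) tests $\varphi$ with values in $[0,1]$ and $\int\varphi\,dP=\alpha$. Let $\Phi$ be the standard normal CDF and $g_\mu(\alpha)=\Phi(\Phi^{-1}(1-\alpha)-\mu)$ (so $g_\mu(0)=1$, $g_\mu(1)=0$). For a family of trade-off functions $h(x')$, $x'\in Z$, the stochastic composition is $$\Big(\bigotimes_{x'\sim\mathcal D}h(x')\Big)(\alpha)=\inf\big\{\mathbb E_{x'\sim\mathcal D}[h(x')(\bar\alpha(x'))] : \bar\alpha:Z\to[0,1]\text{ measurable},\ \mathbb E_{x'\sim\mathcal D}[\bar\alpha(x')]=\alpha\big\}.$$ *Noisy SGD.* Fix $d$. For every run length $t\in\mathbb N$ let there be given a loss $L:\mathbb R^d\times Z\to\mathbb R$ whose gradient $\nabla_\theta L(\theta,z)$ (set to $0$ where $L(\cdot,z)$ is not differentiable) is jointly measurable, an initial law on $\mathbb R^d$, a learning rate $\eta\in\mathbb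 R$, a clipping bound $C\in[0,\infty]$, a noise level $\tau\ge 0$, and integers $1\le n\le N$ (batch size and data set size); all of these may depend on $t$. One step maps parameters $\theta$ and a batch $(b_1,\dots,b_n)$ to $$\theta-\eta\Big(\frac1n\sum_{i=1}^n \mathrm{clip}_C\big(\nabla_\theta L(\theta,b_i)\big)+\tau\xi\Big),\qquad \xi\sim\mathcal N(0,I_d),$$ where $\mathrm{clip}_C(v)=v$ if $\|v\|\le C$ and $Cv/\|v\|$ otherwise. A run draws $\theta_0$ from the initial law and performs $t$ steps. In each step a batch of size $n$ is drawn uniformly without replacement from $N$ points. Under the null hypothesis the $N$ points are i.i.d. from $\mathcal D$; under the alternative with target $x'$, one of them is $x'$ and the other $N-1$ are i.i.d. from $\mathcal D$. The random points, the subsampling and the noise are drawn independently in different steps (the attacker gets independently sampled gradient means in the different steps). Let $A_0^{(t)}$ and $A_1^{(t)}(x')$ be the laws of the published output under the two hypotheses. **Lemma.** Let $\mu_{\rm step}\ge 0$ and $c\in\mathbb R$. Suppose that 1. for every $t$, each single step is at least as hard as $\mu_{\rm step}$-GMIP with respect to the samples of its batch, uniformly over targets and current parameters: for $\mathcal D$-almost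 every $x'$, for all $\theta\in\mathbb R^d$ and $\alpha\in[0,1]$, $\mathrm{Test}(P_\theta;Q_{\theta,x'})(\alpha)\ge g_{\mu_{\rm step}}(\alpha)$, where $P_\theta$ is the law of the step from $\theta$ when its batch consists of $n$ i.i.d. points from $\mathcal D$ and $Q_{\theta,x'}$ is its law when the batch consists of $x'$ and $n-1$ i.i.d. points from $\mathcal D$; 2. $n(t)\sqrt t/N(t)\to c$ as $t\to\infty$. Put $$\mu=\sqrt2\,c\,\sqrt{e^{\mu_{\rm step}^2}\,\Phi(1.5\,\mu_{\rm step})+3\,\Phi(-0.5\,\mu_{\rm step})-2}.$$ Then noisy SGD is $\mu$-GMIP in the limit $t\to\infty$: for every $\varepsilon>0$ there is $t_0$ such that for all $t\ge t_0$ and all $\alpha\in[0,1]$, $$\Big(\bigotimes_{x'\sim\mathcal D}\mathrm{Test}\big(A_0^{(t)};A_1^{(t)}(x')\big)\Big)(\alpha)\ \ge\ g_\mu(\alpha)-\varepsilon .$$ This holds both when the output is the whole sequence of iterates $(\theta_0,\dots,\theta_t)$ and when it is only the final iterate $\theta_t$. -/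

import Mathlib

open MeasureTheory ProbabilityTheory Filter Set
open scoped ENNReal NNReal Gradient Topology

noncomputable section

namespace GMIP

/-! ### Trade-off functions and membership inference privacy -/

/-- The standard normal cumulative distribution function `Φ`. -/
def Phi (x : ℝ) : ℝ := cdf (gaussianReal 0 1) x

/-- The standard normal quantile function `Φ⁻¹`, meaningful on the open interval `(0, 1)`. -/
def PhiInv (p : ℝ) : ℝ := sInf {x : ℝ | p ≤ Phi x}

/-- The Gaussian trade-off function `g_μ(α) = Φ(Φ⁻¹(1 - α) - μ)`; the two endpoints are written out,
with `Φ⁻¹(1) = ∞`, `Φ⁻¹(0) = -∞`, `Φ(∞) = 1` and `Φ(-∞) = 0`. -/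
def gaussTradeoff (μ α : ℝ) : ℝ :=
  if α ≤ 0 then 1 else if 1 ≤ α then 0 else Phi (PhiInv (1 - α) - μ)

/-- The trade-off function `Test(P; Q)`: the infimum of the false negative rate `1 - ∫ φ dQ` over
all measurable (randomized) rejection rules `φ` whose false positive rate `∫ φ dP` equals `α`. -/
def tradeoff {Y : Type*} [MeasurableSpace Y] (P Q : Measure Y) (α : ℝ) : ℝ :=
  sInf {β : ℝ | ∃ φ : Y → ℝ, Measurable φ ∧ (∀ y, φ y ∈ Icc (0 : ℝ) 1) ∧
    ∫ y, φ y ∂P = α ∧ β = 1 - ∫ y, φ y ∂Q}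

/-- The stochastic composition of the trade-off functions `h x'`, `x' ∼ 𝒟`: the smallest global
false negative rate `𝔼[h x' (a x')]` over all measurable test-specific false positive rates
`a : Z → [0, 1]` with `𝔼[a x'] = α`. The expectation of the nonnegative function
`x' ↦ h x' (a x')` is a Lebesgue integral with values in `[0, ∞]`. -/
def stochComp {Z : Type*} [MeasurableSpace Z] (𝒟 : Measure Z) (h : Z → ℝ → ℝ) (α : ℝ) : ℝ :=
  sInf {β : ℝ | ∃ a : Z → ℝ, Measurable a ∧ (∀ z, a z ∈ Icc (0 : ℝ) 1) ∧
    ∫ z, a z ∂𝒟 = α ∧ β = (∫⁻ z, ENNReal.ofReal (h z (a z)) ∂𝒟).toReal}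

/-- `f`-membership inference privacy of an algorithm whose output has law `A₀` when the
target `x'` is not used for training and law `A₁ x'` when it is. -/
def IsMIP {Z Y : Type*} [MeasurableSpace Z] [MeasurableSpace Y] (𝒟 : Measure Z)
    (A₀ : Measure Y) (A₁ : Z → Measure Y) (f : ℝ → ℝ) : Prop :=
  ∀ α ∈ Icc (0 : ℝ) 1, f α ≤ stochComp 𝒟 (fun x' => tradeoff A₀ (A₁ x')) α

/-- A sequence of algorithms (indexed by the length `t` of the run) is `μ`-Gaussian membership
inference private in the limit `t → ∞`: up to an error that is uniform in the false positive rate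
and tends to `0`, the stochastic composition is at least `g_μ`. -/
def IsAsymptoticallyGMIP {Z : Type*} [MeasurableSpace Z] (𝒟 : Measure Z)
    {Y : ℕ → Type} [∀ t, MeasurableSpace (Y t)]
    (A₀ : ∀ t, Measure (Y t)) (A₁ : ∀ t, Z → Measure (Y t)) (μ : ℝ) : Prop :=
  ∀ ε : ℝ, 0 < ε → ∀ᶠ t in atTop, IsMIP 𝒟 (A₀ t) (A₁ t) (fun α => gaussTradeoff μ α - ε)

/-! ### Data sets and batches -/

/-- The law of `k` i.i.d. samples from `𝒟`. -/
def nullData {Z : Type*} [MeasurableSpace Z] (𝒟 : Measure Z) (k : ℕ) : Measure (Fin k → Z) :=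
  Measure.pi fun _ => 𝒟

/-- The law of `k` samples one of which (the one with index `0`) is `x'`, the `k - 1` others being
i.i.d. from `𝒟`. -/
def memberData {Z : Type*} [MeasurableSpace Z] (𝒟 : Measure Z) (k : ℕ) (x' : Z) :
    Measure (Fin k → Z) :=
  Measure.pi fun i => if (i : ℕ) = 0 then Measure.dirac x' else 𝒟

/-- The law of a batch of size `n` drawn uniformly at random without replacement (through a uniform
injection `Fin n ↪ Fin N`) from a data set of size `N` with law `data`. -/
def subsample {Z : Type*} [MeasurableSpace Z] {N : ℕ} (n : ℕ) (data : Measure (Fin N → Z)) :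
    Measure (Fin n → Z) :=
  ((Fintype.card (Fin n ↪ Fin N) : ℝ≥0∞))⁻¹ •
    ∑ e : Fin n ↪ Fin N, data.map (fun S i => S (e i))

/-! ### Noisy SGD -/

/-- Clipping of a vector to norm at most `C`; `C = ∞` means no clipping. -/
def clip {E : Type*} [NormedAddCommGroup E] [NormedSpace ℝ E] (C : ℝ≥0∞) (v : E) : E :=
  if ‖v‖ₑ ≤ C then v else (C.toReal / ‖v‖) • v

/-- The inputs of noisy SGD with `d` model parameters and data points in `Z`. -/
structure NoisySGD (Z : Type*) [MeasurableSpace Z] (d : ℕ) where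
  /-- the loss of the parameters on a data point -/
  loss : EuclideanSpace ℝ (Fin d) → Z → ℝ
  /-- the gradient of the loss in the parameters is jointly measurable -/
  measurable_grad :
    Measurable fun p : EuclideanSpace ℝ (Fin d) × Z => ∇ (fun w => loss w p.2) p.1
  /-- the law of the random initialization -/
  init : Measure (EuclideanSpace ℝ (Fin d))
  /-- the initialization law is a probability measure -/
  init_prob : IsProbabilityMeasure init
  /-- the learning rate `η` -/
  rate : ℝ
  /-- the gradient norm bound `C` -/
  bound : ℝ≥0∞
  /-- the noise scale `τ` -/
  noise : ℝ≥0
  /-- the size `N` of the data set -/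
  N : ℕ
  /-- the batch size `n` -/
  n : ℕ
  /-- batches are not empty -/
  n_pos : 1 ≤ n
  /-- batches are not larger than the data set -/
  n_le : n ≤ N

namespace NoisySGD

variable {Z : Type*} [MeasurableSpace Z] {d : ℕ}

/-- One parameter update from parameters `θ` with batch `b` and standard normal noise `ξ`:
`θ - η ((1/n) ∑ᵢ clip_C (∇_θ L(θ, bᵢ)) + τ ξ)`. -/
def update (A : NoisySGD Z d) (θ : EuclideanSpace ℝ (Fin d)) (b : Fin A.n → Z)
    (ξ : EuclideanSpace ℝ (Fin d)) : EuclideanSpace ℝ (Fin d) :=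
  θ - A.rate • ((A.n : ℝ)⁻¹ • ∑ i, clip A.bound (∇ (fun w => A.loss w (b i)) θ)
    + (A.noise : ℝ) • ξ)

/-- The law of the updated parameters, starting from `θ`, when the batch has law `batch` and the
Gaussian noise is independent of it. -/
def stepLaw (A : NoisySGD Z d) (batch : Measure (Fin A.n → Z)) (θ : EuclideanSpace ℝ (Fin d)) :
    Measure (EuclideanSpace ℝ (Fin d)) :=
  (batch.prod (stdGaussian (EuclideanSpace ℝ (Fin d)))).map fun p => A.update θ p.1 p.2

/-- The joint law of all iterates `(θ₀, …, θ_k)` of a run of `k` steps: in each step, given the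
previous iterates, the batch is drawn with law `batch` and used for one update. -/
def runLaw (A : NoisySGD Z d) (batch : Measure (Fin A.n → Z)) :
    (k : ℕ) → Measure (Fin (k + 1) → EuclideanSpace ℝ (Fin d))
  | 0 => A.init.map fun θ _ => θ
  | k + 1 => (A.runLaw batch k).bind fun ω =>
      (A.stepLaw batch (ω (Fin.last k))).map fun θ =>
        (Fin.snoc ω θ : Fin (k + 2) → EuclideanSpace ℝ (Fin d))

/-- The law of the iterates of `k` steps when the target is not in the training data: in each
step, a batch is subsampled from `N` i.i.d. points. -/
def runNull (A : NoisySGD Z d) (𝒟 : Measure Z) (k : ℕ) :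
    Measure (Fin (k + 1) → EuclideanSpace ℝ (Fin d)) :=
  A.runLaw (subsample A.n (nullData 𝒟 A.N)) k

/-- The law of the iterates of `k` steps when the target `x'` is in the training data: in each
step, a batch is subsampled from `N` points, one of which is `x'` while the others are i.i.d. -/
def runMember (A : NoisySGD Z d) (𝒟 : Measure Z) (k : ℕ) (x' : Z) :
    Measure (Fin (k + 1) → EuclideanSpace ℝ (Fin d)) :=
  A.runLaw (subsample A.n (memberData 𝒟 A.N x')) k

/-- The law of the returned parameters `θ_k` when the target is not in the training data. -/
def finalNull (A : NoisySGD Z d) (𝒟 : Measure Z) (k : ℕ) :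
    Measure (EuclideanSpace ℝ (Fin d)) :=
  (A.runNull 𝒟 k).map fun ω => ω (Fin.last k)

/-- The law of the returned parameters `θ_k` when the target `x'` is in the training data. -/
def finalMember (A : NoisySGD Z d) (𝒟 : Measure Z) (k : ℕ) (x' : Z) :
    Measure (EuclideanSpace ℝ (Fin d)) :=
  (A.runMember 𝒟 k x').map fun ω => ω (Fin.last k)

/-- A single SGD step is at least as hard as `μ`-GMIP with respect to the samples of its batch:
for almost every target `x'` and all current parameters `θ`, testing a step whose whole batch is
i.i.d. from `𝒟` against a step whose batch contains `x'` has trade-off function at least `g_μ`. -/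
def IsStepGMIP (A : NoisySGD Z d) (𝒟 : Measure Z) (μ : ℝ) : Prop :=
  ∀ᵐ x' ∂𝒟, ∀ θ : EuclideanSpace ℝ (Fin d), ∀ α ∈ Icc (0 : ℝ) 1,
    gaussTradeoff μ α ≤
      tradeoff (A.stepLaw (nullData 𝒟 A.n) θ) (A.stepLaw (memberData 𝒟 A.n x') θ) α

end NoisySGD

end GMIP

end

namespace GMIP

/-! ### The standard normal distribution function -/

/-! Trade-off curves are handled through their supporting lines. If the log-likelihood ratio of a
pair of hypotheses has law `ρ` under the null, then by Neyman–Pearson the least weighted error `s ·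
FNR + r · FPR` is `∫ min (s e^y) r dρ`. `TestDominated P Q ρ` says that no test between `P` and `Q`
does better than this. The relation survives post-processing (`TestDominated.map`), and under
adaptive composition the laws `ρ` are convolved (`TestDominated.bind`).

Averaging over the subsampling, a step that may use the target is the mixture of the null step and
the target step with weight `p = n/N` on the latter (`NoisySGD.stepLaw_subsample_memberData`). By
the one-step hypothesis it is dominated by the log-likelihood ratio of `(1 - p) 𝒩(0,1) + p
𝒩(μstep,1)` against `𝒩(0,1)`, for almost every target and every current parameter
(`testDominated_mixture`). Hence `t` steps are dominated by the `t`-fold convolution power of that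
law.

Since `p √t → c`, a central limit theorem (`tendsto_integral_convPow_mixtureLogLR`) gives as limit
the log-likelihood ratio of `𝒩(σ,1)` against `𝒩(0,1)`, where `σ = c √(e^{μstep²} - 1)`: the radicand
is the χ²-divergence of the Gaussian pair. Each lower bound is affine in the false positive rate and
the same for almost all targets, so it passes to the stochastic composition (`le_stochComp`). Its
convergence is uniform from below in the slope (`eventually_forall_integral_min_ge`), so the lines
combine to `g_σ - ε`.

Finally `σ ≤ μ`. The χ²-divergence splits at likelihood ratio `1`; the part above `1` has the stated
closed form and is at least as large as the part below (`exp_sq_sub_one_le`). This is the origin of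
the factor `√2`. -/

lemma Phi_eq_measureReal (x : ℝ) : Phi x = (gaussianReal 0 1).real (Iic x) :=
  cdf_eq_real _ x

lemma monotone_Phi : Monotone Phi := monotone_cdf _

lemma continuous_Phi : Continuous Phi := by
  have hN := nullSingletonClass_gaussianReal (μ := 0) (v := 1) one_ne_zero
  refine continuous_iff_continuousAt.2 fun x => ?_
  refine continuousAt_iff_continuous_left'_right'.2 ⟨?_, ?_⟩
  · refine (monotone_Phi.continuousWithinAt_Iio_iff_leftLim_eq).2 ?_
    have h : (cdf (gaussianReal 0 1)).measure {x} = 0 := by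
      rw [measure_cdf]; exact measure_singleton x
    rw [StieltjesFunction.measure_singleton, ENNReal.ofReal_eq_zero] at h
    exact le_antisymm (monotone_Phi.leftLim_le le_rfl) (by
      change cdf (gaussianReal 0 1) x ≤ Function.leftLim (cdf (gaussianReal 0 1)) x
      linarith)
  · exact ((cdf (gaussianReal 0 1)).right_continuous x).mono Ioi_subset_Ici_self

lemma Phi_PhiInv {p : ℝ} (hp : p ∈ Ioo (0 : ℝ) 1) : Phi (PhiInv p) = p := by
  have hbot : Tendsto Phi atBot (𝓝 0) := tendsto_cdf_atBot _
  have htop : Tendsto Phi atTop (𝓝 1) := tendsto_cdf_atTop _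
  obtain ⟨a, ha⟩ := (hbot.eventually (gt_mem_nhds hp.1)).exists
  obtain ⟨b, hb⟩ := (htop.eventually (lt_mem_nhds hp.2)).exists
  have hbdd : BddBelow {x | p ≤ Phi x} := by
    refine ⟨a, fun x hx => ?_⟩
    by_contra! h
    exact absurd (monotone_Phi h.le) (by have : p ≤ Phi x := hx; linarith)
  have hclosed : IsClosed {x | p ≤ Phi x} := isClosed_le continuous_const continuous_Phi
  refine le_antisymm ?_ (hclosed.csInf_mem ⟨b, hb.le⟩ hbdd)
  obtain ⟨x, hx⟩ := mem_range_of_exists_le_of_exists_ge continuous_Phi ⟨a, ha.le⟩ ⟨b, hb.le⟩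
  exact (monotone_Phi (csInf_le hbdd hx.ge)).trans hx.le

/-! ### The Gaussian likelihood ratio -/

/-- The likelihood ratio of `𝒩(μ, 1)` with respect to `𝒩(0, 1)`. -/
noncomputable def gaussLR (μ x : ℝ) : ℝ := Real.exp (μ * x - μ ^ 2 / 2)

lemma gaussLR_pos (μ x : ℝ) : 0 < gaussLR μ x := Real.exp_pos _

@[fun_prop]
lemma continuous_gaussLR (μ : ℝ) : Continuous (gaussLR μ) := by
  unfold gaussLR; fun_prop

lemma gaussLR_pow (μ x : ℝ) (k : ℕ) :
    gaussLR μ x ^ k = Real.exp (-k * μ ^ 2 / 2) * Real.exp ((k * μ) * x) := by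
  rw [gaussLR, ← Real.exp_nat_mul, ← Real.exp_add]; congr 1; ring

lemma integrable_gaussLR_pow (μ : ℝ) (k : ℕ) :
    Integrable (fun x => gaussLR μ x ^ k) (gaussianReal 0 1) := by
  simp_rw [gaussLR_pow]
  exact (integrable_exp_mul_gaussianReal _).const_mul _

lemma integrable_gaussLR (μ : ℝ) : Integrable (gaussLR μ) (gaussianReal 0 1) := by
  simpa using integrable_gaussLR_pow μ 1

lemma integral_exp_mul_stdNormal (s : ℝ) :
    ∫ x, Real.exp (s * x) ∂(gaussianReal 0 1) = Real.exp (s ^ 2 / 2) := by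
  have h := mgf_gaussianReal (p := gaussianReal 0 1) (X := id) (μ := 0) (v := 1) (by simp) s
  simpa [mgf] using h

lemma integral_gaussLR (μ : ℝ) : ∫ x, gaussLR μ x ∂(gaussianReal 0 1) = 1 := by
  have h := fun x => gaussLR_pow μ x 1
  simp only [pow_one] at h
  simp_rw [h]
  rw [integral_const_mul, integral_exp_mul_stdNormal, ← Real.exp_add, Real.exp_eq_one_iff]
  push_cast; ring

lemma integral_gaussLR_sq (μ : ℝ) :
    ∫ x, gaussLR μ x ^ 2 ∂(gaussianReal 0 1) = Real.exp (μ ^ 2) := by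
  simp_rw [gaussLR_pow]
  rw [integral_const_mul, integral_exp_mul_stdNormal, ← Real.exp_add]
  congr 1; push_cast; ring

/-- Reweighting the standard normal by its likelihood ratio is a translation. -/
lemma integral_gaussLR_mul (μ : ℝ) (f : ℝ → ℝ) :
    ∫ x, gaussLR μ x * f x ∂(gaussianReal 0 1) = ∫ x, f (x + μ) ∂(gaussianReal 0 1) := by
  rw [integral_gaussianReal_eq_integral_smul one_ne_zero,
    integral_gaussianReal_eq_integral_smul one_ne_zero,
    ← integral_add_right_eq_self _ μ]
  congr 1 with x
  simp only [smul_eq_mul, gaussianPDFReal, gaussLR, sub_zero, NNReal.coe_one, mul_one]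
  rw [mul_assoc, mul_assoc, ← mul_assoc (Real.exp _), ← Real.exp_add]
  congr 3; ring

lemma integral_neg_stdNormal (f : ℝ → ℝ) :
    ∫ x, f (-x) ∂(gaussianReal 0 1) = ∫ x, f x ∂(gaussianReal 0 1) := by
  conv_rhs => rw [← neg_zero (G := ℝ), ← gaussianReal_map_neg]
  exact ((MeasurableEquiv.neg ℝ).measurableEmbedding.integral_map f).symm

lemma integral_indicator_Iic (z : ℝ) :
    ∫ x, (Iic z).indicator (fun _ => (1 : ℝ)) x ∂(gaussianReal 0 1) = Phi z := by
  rw [integral_indicator measurableSet_Iic, Phi_eq_measureReal]; simp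

lemma integral_indicator_Ioi (z : ℝ) :
    ∫ x, (Ioi z).indicator (fun _ => (1 : ℝ)) x ∂(gaussianReal 0 1) = 1 - Phi z := by
  rw [integral_indicator measurableSet_Ioi, Phi_eq_measureReal, ← compl_Iic,
    ← probReal_compl_eq_one_sub measurableSet_Iic]; simp

lemma Phi_neg (z : ℝ) : Phi (-z) = 1 - Phi z := by
  have hN := nullSingletonClass_gaussianReal (μ := 0) (v := 1) one_ne_zero
  rw [← integral_indicator_Iic, ← integral_neg_stdNormal,
    Phi_eq_measureReal, ← probReal_compl_eq_one_sub measurableSet_Iic, compl_Iic,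
    measureReal_congr (Ioi_ae_eq_Ici (μ := gaussianReal 0 1) (a := z)),
    ← integral_indicator_one measurableSet_Ici]
  congr 1 with x
  simp [indicator]

lemma integral_gaussLR_mul_Iic (μ z : ℝ) :
    ∫ x, gaussLR μ x * (Iic z).indicator (fun _ => (1 : ℝ)) x ∂(gaussianReal 0 1)
      = Phi (z - μ) := by
  rw [integral_gaussLR_mul, ← integral_indicator_Iic]
  congr 1 with x
  simp [indicator, le_sub_iff_add_le]

lemma integral_gaussLR_mul_Ioi (μ z : ℝ) :
    ∫ x, gaussLR μ x * (Ioi z).indicator (fun _ => (1 : ℝ)) x ∂(gaussianReal 0 1)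
      = 1 - Phi (z - μ) := by
  rw [integral_gaussLR_mul, ← integral_indicator_Ioi]
  congr 1 with x
  simp [indicator, sub_lt_iff_lt_add]

lemma integrable_gaussLR_pow_mul_indicator (μ : ℝ) (k : ℕ) {s : Set ℝ} (hs : MeasurableSet s) :
    Integrable (fun x => gaussLR μ x ^ k * s.indicator (fun _ => (1 : ℝ)) x)
      (gaussianReal 0 1) := by
  refine ((integrable_gaussLR_pow μ k).indicator hs).congr (ae_of_all _ fun x => ?_)
  simp [indicator]

/-! ### The Gaussian trade-off function and its supporting lines -/

lemma integrable_min_mixture (μ s r p : ℝ) :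
    Integrable (fun x => min (s * (1 - p + p * gaussLR μ x)) r) (gaussianReal 0 1) :=
  (((integrable_const _).add ((integrable_gaussLR μ).const_mul p)).const_mul s).inf
    (integrable_const r)

/-- Neyman–Pearson for the pair `𝒩(0, 1)`, `(1 - p) 𝒩(0, 1) + p 𝒩(μ, 1)`. -/
lemma integral_min_mixture_le (μ : ℝ) {s r p α : ℝ} (hα : α ∈ Icc (0 : ℝ) 1) :
    ∫ x, min (s * (1 - p + p * gaussLR μ x)) r ∂(gaussianReal 0 1)
      ≤ s * (p * gaussTradeoff μ α + (1 - p) * (1 - α)) + r * α := by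
  have hint := integrable_min_mixture μ s r p
  have hint1 : Integrable (fun x => s * (1 - p + p * gaussLR μ x)) (gaussianReal 0 1) :=
    ((integrable_const _).add ((integrable_gaussLR μ).const_mul p)).const_mul s
  -- The quantile is only meaningful in the open interval; at each endpoint one branch of the
  -- minimum alone suffices.
  rcases hα.1.eq_or_lt with rfl | h0
  · refine (integral_mono hint hint1 fun x => min_le_left _ _).trans (le_of_eq ?_)
    rw [integral_const_mul, integral_add (integrable_const _)
      ((integrable_gaussLR μ).const_mul p), integral_const_mul, integral_gaussLR]
    simp [gaussTradeoff]
  rcases hα.2.eq_or_lt with rfl | h1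
  · refine (integral_mono hint (integrable_const r) fun x => min_le_right _ _).trans (le_of_eq ?_)
    simp [gaussTradeoff]
  have hz : Phi (PhiInv (1 - α)) = 1 - α := Phi_PhiInv ⟨by linarith, by linarith⟩
  have hg : gaussTradeoff μ α = Phi (PhiInv (1 - α) - μ) := by
    simp [gaussTradeoff, h0.not_ge, h1.not_ge]
  set z := PhiInv (1 - α)
  have hI : Integrable ((Iic z).indicator (fun _ => (1 : ℝ))) (gaussianReal 0 1) :=
    (integrable_const _).indicator measurableSet_Iic
  have hO : Integrable ((Ioi z).indicator (fun _ => (1 : ℝ))) (gaussianReal 0 1) :=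
    (integrable_const _).indicator measurableSet_Ioi
  have hL := integrable_gaussLR_pow_mul_indicator μ 1 (measurableSet_Iic (a := z))
  simp only [pow_one] at hL
  -- The minimum is bounded by its first entry up to `z` and by its second beyond. Rejecting beyond
  -- the quantile `z` is the test of level `α` whose errors define `g_μ(α)`.
  calc ∫ x, min (s * (1 - p + p * gaussLR μ x)) r ∂(gaussianReal 0 1)
      ≤ ∫ x, ((s * (1 - p) * (Iic z).indicator (fun _ => (1 : ℝ)) x
          + s * p * (gaussLR μ x * (Iic z).indicator (fun _ => (1 : ℝ)) x))
          + r * (Ioi z).indicator (fun _ => (1 : ℝ)) x) ∂(gaussianReal 0 1) := by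
        refine integral_mono hint (((hI.const_mul _).add (hL.const_mul _)).add (hO.const_mul _))
          fun x => ?_
        rcases le_or_gt x z with hx | hx
        · simp only [indicator, mem_Iic, hx, mem_Ioi, hx.not_gt, if_true, if_false]
          exact (min_le_left _ _).trans (le_of_eq (by ring))
        · simp only [indicator, mem_Iic, hx, mem_Ioi, hx.not_ge, if_true, if_false]
          exact (min_le_right _ _).trans (le_of_eq (by ring))
    _ = s * (p * gaussTradeoff μ α + (1 - p) * (1 - α)) + r * α := by
        have h1 := hI.const_mul (s * (1 - p))
        have h2 := hL.const_mul (s * p)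
        have h3 := hO.const_mul r
        rw [integral_add (f := fun x => s * (1 - p) * (Iic z).indicator (fun _ => (1 : ℝ)) x
          + s * p * (gaussLR μ x * (Iic z).indicator (fun _ => (1 : ℝ)) x)) (h1.add h2) h3,
          integral_add h1 h2, integral_const_mul, integral_const_mul,
          integral_const_mul, integral_indicator_Iic, integral_gaussLR_mul_Iic,
          integral_indicator_Ioi, hg, hz]
        ring

/-- Every interior point of the graph of `g_μ` has a supporting line. -/
lemma exists_integral_min_eq {μ α : ℝ} (hμ : 0 ≤ μ) (hα : α ∈ Ioo (0 : ℝ) 1) :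
    ∃ r : ℝ, 0 ≤ r ∧
      ∫ x, min (gaussLR μ x) r ∂(gaussianReal 0 1) = gaussTradeoff μ α + r * α := by
  have hz : Phi (PhiInv (1 - α)) = 1 - α :=
    Phi_PhiInv ⟨by linarith [hα.2], by linarith [hα.1]⟩
  have hg : gaussTradeoff μ α = Phi (PhiInv (1 - α) - μ) := by
    simp [gaussTradeoff, hα.1.not_ge, hα.2.not_ge]
  set z := PhiInv (1 - α)
  -- The slope is the likelihood ratio at the threshold. As `μ ≥ 0` the ratio is monotone, so the
  -- minimum changes branch exactly at `z` and nothing is lost.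
  refine ⟨gaussLR μ z, (gaussLR_pos μ z).le, ?_⟩
  have hO : Integrable ((Ioi z).indicator (fun _ => (1 : ℝ))) (gaussianReal 0 1) :=
    (integrable_const _).indicator measurableSet_Ioi
  have hL := integrable_gaussLR_pow_mul_indicator μ 1 (measurableSet_Iic (a := z))
  simp only [pow_one] at hL
  have heq : ∀ x, min (gaussLR μ x) (gaussLR μ z)
      = gaussLR μ x * (Iic z).indicator (fun _ => (1 : ℝ)) x
        + gaussLR μ z * (Ioi z).indicator (fun _ => (1 : ℝ)) x := by
    intro x
    rcases le_or_gt x z with hx | hx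
    · have : gaussLR μ x ≤ gaussLR μ z := Real.exp_le_exp.2 (by gcongr)
      simp [indicator, hx, hx.not_gt, this]
    · have : gaussLR μ z ≤ gaussLR μ x := Real.exp_le_exp.2 (by gcongr)
      simp [indicator, hx, hx.not_ge, this]
  simp_rw [heq]
  rw [integral_add hL (hO.const_mul _), integral_const_mul, integral_gaussLR_mul_Iic,
    integral_indicator_Ioi, hg, hz]
  ring

lemma gaussTradeoff_anti {μ ν : ℝ} (h : μ ≤ ν) (α : ℝ) :
    gaussTradeoff ν α ≤ gaussTradeoff μ α := by
  unfold gaussTradeoff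
  split_ifs
  · exact le_rfl
  · exact le_rfl
  · exact monotone_Phi (by linarith)

/-! ### The two halves of the χ²-divergence -/

lemma integrable_posPart_sq (μ : ℝ) :
    Integrable (fun x => (max (gaussLR μ x - 1) 0) ^ 2) (gaussianReal 0 1) := by
  refine ((integrable_gaussLR_pow μ 2).add (integrable_const 1)).mono'
    (Continuous.aestronglyMeasurable (by fun_prop)) (ae_of_all _ fun x => ?_)
  have := gaussLR_pos μ x
  rw [Real.norm_of_nonneg (by positivity)]
  simp only [Pi.add_apply]
  rcases max_cases (gaussLR μ x - 1) 0 with ⟨h, h'⟩ | ⟨h, h'⟩ <;> rw [h] <;> nlinarith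

lemma integrable_negPart_sq (μ : ℝ) :
    Integrable (fun x => (max (1 - gaussLR μ x) 0) ^ 2) (gaussianReal 0 1) := by
  refine (integrable_const (1 : ℝ)).mono'
    (Continuous.aestronglyMeasurable (by fun_prop)) (ae_of_all _ fun x => ?_)
  have := gaussLR_pos μ x
  rw [Real.norm_of_nonneg (by positivity)]
  rcases max_cases (1 - gaussLR μ x) 0 with ⟨h, h'⟩ | ⟨h, h'⟩ <;> rw [h] <;> nlinarith

/-- The ratio crosses `1` at `μ/2`, and its square is `e^{μ²}` times the ratio of `𝒩(2μ, 1)`.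
Expanding the square leaves Gaussian tails beyond `μ/2` under the means `2μ`, `μ` and `0`; the last
two combine into the coefficient `3`. -/
lemma integral_posPart_sq {μ : ℝ} (hμ : 0 ≤ μ) :
    ∫ x, (max (gaussLR μ x - 1) 0) ^ 2 ∂(gaussianReal 0 1)
      = Real.exp (μ ^ 2) * Phi (1.5 * μ) + 3 * Phi (-0.5 * μ) - 2 := by
  set O : ℝ → ℝ := (Ioi (μ / 2)).indicator (fun _ => (1 : ℝ)) with hOdef
  have hsq : ∀ x, gaussLR μ x ^ 2 = Real.exp (μ ^ 2) * gaussLR (2 * μ) x := fun x => by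
    rw [gaussLR, gaussLR, ← Real.exp_nat_mul, ← Real.exp_add]; congr 1; push_cast; ring
  have heq : ∀ x, (max (gaussLR μ x - 1) 0) ^ 2
      = (Real.exp (μ ^ 2) * (gaussLR (2 * μ) x * O x) - 2 * (gaussLR μ x * O x)) + O x := by
    intro x
    rw [← mul_assoc, ← hsq]
    rcases le_or_gt x (μ / 2) with hx | hx
    · have h1 : gaussLR μ x ≤ 1 := Real.exp_le_one_iff.2 (by nlinarith)
      rw [max_eq_right (by linarith)]
      simp [hOdef, hx]
    · have h1 : 1 ≤ gaussLR μ x := Real.one_le_exp (by nlinarith)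
      rw [max_eq_left (by linarith)]
      simp only [hOdef, indicator, mem_Ioi, hx, if_true]; ring
  have hL : ∀ ν, Integrable (fun x => gaussLR ν x * O x) (gaussianReal 0 1) := fun ν => by
    simpa using integrable_gaussLR_pow_mul_indicator ν 1 (measurableSet_Ioi (a := μ / 2))
  have hO : Integrable O (gaussianReal 0 1) := (integrable_const _).indicator measurableSet_Ioi
  have h1 := (hL (2 * μ)).const_mul (Real.exp (μ ^ 2))
  have h2 := (hL μ).const_mul 2
  simp_rw [heq]
  rw [integral_add (f := fun x => Real.exp (μ ^ 2) * (gaussLR (2 * μ) x * O x)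
      - 2 * (gaussLR μ x * O x)) (h1.sub h2) hO, integral_sub h1 h2, integral_const_mul,
    integral_const_mul, integral_gaussLR_mul_Ioi, integral_gaussLR_mul_Ioi,
    integral_indicator_Ioi, ← Phi_neg, ← Phi_neg (μ / 2),
    show -(μ / 2 - 2 * μ) = 1.5 * μ by ring, show μ / 2 - μ = -0.5 * μ by ring,
    show -(μ / 2) = -0.5 * μ by ring]
  ring

/-- The reflection `x ↦ μ - x` exchanges `𝒩(0,1)` and `𝒩(μ,1)` and inverts the ratio `L`. It turns
the left side into the integral of `(L - 1)²/L` over `L > 1`, where dividing by `L` only decreases.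
-/
lemma integral_negPart_sq_le (μ : ℝ) :
    ∫ x, (max (1 - gaussLR μ x) 0) ^ 2 ∂(gaussianReal 0 1)
      ≤ ∫ x, (max (gaussLR μ x - 1) 0) ^ 2 ∂(gaussianReal 0 1) := by
  have h1 : ∀ x, (max (1 - gaussLR μ x) 0) ^ 2
      = gaussLR μ x * ((max (1 - gaussLR μ x) 0) ^ 2 / gaussLR μ x) := fun x => by
    field_simp [(gaussLR_pos μ x).ne']
  have hinv : ∀ x, gaussLR μ (-x + μ) = (gaussLR μ x)⁻¹ := fun x => by
    rw [gaussLR, gaussLR, ← Real.exp_neg]; congr 1; ring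
  rw [integral_congr_ae (ae_of_all _ h1), integral_gaussLR_mul μ fun x => (max (1 - gaussLR μ x) 0) ^ 2 / gaussLR μ x,
    ← integral_neg_stdNormal]
  refine integral_mono_of_nonneg (ae_of_all _ fun x => ?_) (integrable_posPart_sq μ)
    (ae_of_all _ fun x => ?_)
  · exact div_nonneg (sq_nonneg _) (gaussLR_pos _ _).le
  · simp only [hinv]
    have hpos := gaussLR_pos μ x
    rcases le_or_gt (gaussLR μ x) 1 with h | h
    · rw [max_eq_right (by linarith [(one_le_inv₀ hpos).2 h])]
      simp
    · rw [max_eq_left (by linarith [inv_lt_one_of_one_lt₀ h]), max_eq_left (by linarith)]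
      have : (1 - (gaussLR μ x)⁻¹) ^ 2 / (gaussLR μ x)⁻¹ = (gaussLR μ x - 1) ^ 2 / gaussLR μ x := by
        field_simp
      rw [this]
      exact div_le_self (sq_nonneg _) h.le

lemma integral_gaussLR_sub_one_sq (μ : ℝ) :
    ∫ x, (gaussLR μ x - 1) ^ 2 ∂(gaussianReal 0 1) = Real.exp (μ ^ 2) - 1 := by
  have h1 := integrable_gaussLR_pow μ 2
  have h2 := (integrable_gaussLR μ).const_mul 2
  have heq : ∀ x, (gaussLR μ x - 1) ^ 2 = (gaussLR μ x ^ 2 - 2 * gaussLR μ x) + 1 :=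
    fun x => by ring
  simp_rw [heq]
  rw [integral_add (f := fun x => gaussLR μ x ^ 2 - 2 * gaussLR μ x) (h1.sub h2)
    (integrable_const _), integral_sub h1 h2, integral_const_mul, integral_gaussLR_sq,
    integral_gaussLR]
  simp; ring

lemma exp_sq_sub_one_le {μ : ℝ} (hμ : 0 ≤ μ) :
    Real.exp (μ ^ 2) - 1
      ≤ 2 * (Real.exp (μ ^ 2) * Phi (1.5 * μ) + 3 * Phi (-0.5 * μ) - 2) := by
  rw [← integral_posPart_sq hμ, ← integral_gaussLR_sub_one_sq]
  have heq : ∀ x, (gaussLR μ x - 1) ^ 2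
      = (max (gaussLR μ x - 1) 0) ^ 2 + (max (1 - gaussLR μ x) 0) ^ 2 := fun x => by
    rcases le_total (gaussLR μ x) 1 with h | h
    · rw [max_eq_right (by linarith), max_eq_left (by linarith)]; ring
    · rw [max_eq_left (by linarith), max_eq_right (by linarith)]; ring
  simp_rw [heq]
  rw [integral_add (integrable_posPart_sq μ) (integrable_negPart_sq μ)]
  linarith [integral_negPart_sq_le μ]

/-! ### A central limit theorem for the log-likelihood ratio of a mixture -/

/-- If the third derivative is bounded by `K`, the second order Taylor remainder is at most
`K |x|³`. -/
lemma norm_taylor_two_remainder_le {f f' f'' f''' : ℝ → ℂ} {a K : ℝ} (ha : a ≤ 0)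
    (hf : ∀ x ∈ Ici a, HasDerivAt f (f' x) x) (hf' : ∀ x ∈ Ici a, HasDerivAt f' (f'' x) x)
    (hf'' : ∀ x ∈ Ici a, HasDerivAt f'' (f''' x) x) (hK : ∀ x ∈ Ici a, ‖f''' x‖ ≤ K)
    {x : ℝ} (hx : x ∈ Ici a) :
    ‖f x - f 0 - f' 0 * x - f'' 0 / 2 * x ^ 2‖ ≤ K * |x| ^ 3 := by
  have hK0 : 0 ≤ K := (norm_nonneg _).trans (hK x hx)
  have hsub : ∀ y : ℝ, ∀ z ∈ uIcc 0 y, y ∈ Ici a → z ∈ Ici a := fun y z hz hy => by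
    rcases le_total 0 y with h | h
    · rw [uIcc_of_le h] at hz; exact ha.trans hz.1
    · rw [uIcc_of_ge h] at hz; exact le_trans hy hz.1
  have habs : ∀ y : ℝ, ∀ z ∈ uIcc 0 y, |z| ≤ |y| := fun y z hz => by
    simpa using abs_sub_left_of_mem_uIcc hz
  -- Mean value inequality on the segment from `0` to `y`. Its three applications each contribute a
  -- factor `|y|`; the factor `1/6` is given up.
  have step : ∀ (g g' : ℝ → ℂ) (C : ℝ → ℝ), (∀ y ∈ Ici a, HasDerivAt g (g' y) y) →
      (∀ y ∈ Ici a, ∀ z ∈ uIcc 0 y, ‖g' z‖ ≤ C y) → ∀ y ∈ Ici a,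
      ‖g y - g 0‖ ≤ C y * |y| := fun g g' C hg hC y hy => by
    have := (convex_uIcc 0 y).norm_image_sub_le_of_norm_hasDerivWithin_le
      (fun z hz => (hg z (hsub y z hz hy)).hasDerivWithinAt) (hC y hy) left_mem_uIcc
      right_mem_uIcc
    simpa using this
  have s1 : ∀ y ∈ Ici a, ‖f'' y - f'' 0‖ ≤ K * |y| :=
    step f'' f''' (fun _ => K) hf'' fun y hy z hz => hK z (hsub y z hz hy)
  have s2 : ∀ y ∈ Ici a, ‖f' y - f' 0 - f'' 0 * y‖ ≤ K * |y| ^ 2 := fun y hy => by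
    have := step (fun y => f' y - f'' 0 * y) (fun y => f'' y - f'' 0) (fun y => K * |y|)
      (fun y hy => by
        have h := (hf' y hy).sub ((Complex.ofRealCLM.hasDerivAt (x := y)).const_mul (f'' 0))
        exact h.congr_deriv (by simp))
      (fun y hy z hz => (s1 z (hsub y z hz hy)).trans
        (mul_le_mul_of_nonneg_left (habs y z hz) hK0)) y hy
    calc ‖f' y - f' 0 - f'' 0 * y‖ = ‖f' y - f'' 0 * y - (f' 0 - f'' 0 * (0 : ℝ))‖ := by
          congr 1; push_cast; ring
      _ ≤ _ := this.trans (le_of_eq (by ring))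
  have := step (fun y => f y - f' 0 * y - f'' 0 / 2 * y ^ 2)
      (fun y => f' y - f' 0 - f'' 0 * y) (fun y => K * |y| ^ 2)
      (fun y hy => by
        have hc := Complex.ofRealCLM.hasDerivAt (x := y)
        have h := ((hf y hy).sub (hc.const_mul (f' 0))).sub ((hc.pow 2).const_mul (f'' 0 / 2))
        refine h.congr_deriv ?_
        simp; ring)
      (fun y hy z hz => (s2 z (hsub y z hz hy)).trans
        (mul_le_mul_of_nonneg_left (pow_le_pow_left₀ (abs_nonneg _) (habs y z hz) 2) hK0)) x hx
  calc ‖f x - f 0 - f' 0 * x - f'' 0 / 2 * x ^ 2‖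
      = ‖f x - f' 0 * x - f'' 0 / 2 * x ^ 2
        - (f 0 - f' 0 * (0 : ℝ) - f'' 0 / 2 * (0 : ℝ) ^ 2)‖ := by
        congr 1; push_cast; ring
    _ ≤ _ := this.trans (le_of_eq (by ring))

/-- The functions `a (1 + x)^(b - k)` are closed under differentiation, so this one formula yields
all three derivatives of `(1 + x)^b`. -/
lemma hasDerivAt_mul_cexp_log (a b : ℂ) (k : ℕ) {x : ℝ} (hx : -(1 / 2) ≤ x) :
    HasDerivAt (fun x : ℝ => a * (Complex.exp (b * Real.log (1 + x)) / (1 + x) ^ k))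
      (a * (b - k) * (Complex.exp (b * Real.log (1 + x)) / (1 + x) ^ (k + 1))) x := by
  have h1 : (0 : ℝ) < 1 + x := by linarith
  have h1' : (1 + x : ℂ) ≠ 0 := by exact_mod_cast h1.ne'
  have hlog : HasDerivAt (fun x : ℝ => (Real.log (1 + x) : ℂ)) ((1 + x : ℝ)⁻¹ : ℂ) x := by
    have := ((Real.hasDerivAt_log h1.ne').comp_const_add 1 x).ofReal_comp
    simpa using this
  have hexp := (hlog.const_mul b).cexp
  have hlin : HasDerivAt (fun x : ℝ => (1 + x : ℂ)) 1 x := by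
    simpa using (Complex.ofRealCLM.hasDerivAt (x := x)).const_add (1 : ℂ)
  have h := (hexp.div (hlin.pow k) (pow_ne_zero k h1')).const_mul a
  refine h.congr_deriv ?_
  rcases k with _ | k
  · simp; field_simp
  · simp only [Pi.pow_apply, Nat.add_sub_cancel]
    push_cast
    field_simp
    ring

/-- The cubic remainder of `(1 + x)^{iu}`. -/
lemma exists_norm_cexp_log_taylor_le (u : ℝ) : ∃ K : ℝ, 0 ≤ K ∧ ∀ x : ℝ, -(1 / 2) ≤ x →
    ‖Complex.exp (u * Real.log (1 + x) * Complex.I) - 1 - u * Complex.I * x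
      - u * Complex.I * (u * Complex.I - 1) / 2 * x ^ 2‖ ≤ K * |x| ^ 3 := by
  set b : ℂ := u * Complex.I with hb
  set F : ℂ → ℕ → ℝ → ℂ := fun a k x => a * (Complex.exp (b * Real.log (1 + x)) / (1 + x) ^ k)
  -- Here `|(1 + x)^{iu}| = 1`, and `8` bounds `(1 + x)^{-3}` when `1 + x ≥ 1/2`.
  refine ⟨‖b * (b - 1) * (b - 2)‖ * 8, by positivity, fun x hx => ?_⟩
  have hK : ∀ y ∈ Ici (-(1 / 2) : ℝ), ‖F (b * (b - 1) * (b - 2)) 3 y‖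
      ≤ ‖b * (b - 1) * (b - 2)‖ * 8 := fun y hy => by
    have h1 : (1 / 2 : ℝ) ≤ 1 + y := by have : -(1 / 2) ≤ y := hy; linarith
    simp only [F, norm_mul (b * (b - 1) * (b - 2)), norm_div]
    gcongr
    have e1 : ‖Complex.exp (b * Real.log (1 + y))‖ = 1 := by
      rw [hb, show (u : ℂ) * Complex.I * Real.log (1 + y)
        = ((u * Real.log (1 + y) : ℝ) : ℂ) * Complex.I by push_cast; ring]
      exact Complex.norm_exp_ofReal_mul_I _
    have e2 : ‖((1 : ℂ) + y) ^ 3‖ = (1 + y) ^ 3 := by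
      rw [norm_pow, show (1 : ℂ) + y = ((1 + y : ℝ) : ℂ) by push_cast; ring, Complex.norm_real,
        Real.norm_of_nonneg (by linarith)]
    rw [e1, e2, div_le_iff₀ (by positivity)]
    have : (1 / 2 : ℝ) ^ 3 ≤ (1 + y) ^ 3 := by gcongr
    linarith
  have h := norm_taylor_two_remainder_le (f := F 1 0) (f' := F b 1) (f'' := F (b * (b - 1)) 2)
    (f''' := F (b * (b - 1) * (b - 2)) 3) (a := -(1 / 2)) (by norm_num)
    (fun y hy => by simpa [F] using hasDerivAt_mul_cexp_log 1 b 0 hy)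
    (fun y hy => by simpa [F] using hasDerivAt_mul_cexp_log b b 1 hy)
    (fun y hy => by simpa [F] using hasDerivAt_mul_cexp_log (b * (b - 1)) b 2 hy) hK hx
  simp only [F, pow_zero, div_one, one_mul, Complex.ofReal_zero, add_zero, one_pow, Real.log_one,
    mul_zero, Complex.exp_zero, mul_one] at h
  convert h using 6
  ring

/-- The law of the log-likelihood ratio of `(1 - p) 𝒩(0, 1) + p 𝒩(μ, 1)` with respect to
`𝒩(0, 1)`, under the latter. -/
noncomputable def mixtureLogLR (μ p : ℝ) : Measure ℝ :=
  (gaussianReal 0 1).map fun x => Real.log (1 + p * (gaussLR μ x - 1))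

lemma measurable_mixtureLogLR (μ p : ℝ) :
    Measurable fun x => Real.log (1 + p * (gaussLR μ x - 1)) :=
  Real.measurable_log.comp (Continuous.measurable (by fun_prop))

instance (μ p : ℝ) : IsProbabilityMeasure (mixtureLogLR μ p) :=
  Measure.isProbabilityMeasure_map (measurable_mixtureLogLR μ p).aemeasurable

lemma charFun_mixtureLogLR (μ p u : ℝ) :
    charFun (mixtureLogLR μ p) u = ∫ x, Complex.exp
      (u * Real.log (1 + p * (gaussLR μ x - 1)) * Complex.I) ∂(gaussianReal 0 1) := by
  rw [charFun_apply_real, mixtureLogLR,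
    integral_map (measurable_mixtureLogLR μ p).aemeasurable]
  exact (Continuous.aestronglyMeasurable (by fun_prop))

lemma integrable_gaussLR_sub_one_pow (μ : ℝ) (k : ℕ) :
    Integrable (fun x => (gaussLR μ x - 1) ^ k) (gaussianReal 0 1) := by
  simp_rw [sub_eq_add_neg, add_pow]
  refine integrable_finsetSum _ fun i _ => ?_
  exact ((integrable_gaussLR_pow μ i).mul_const _).mul_const _

/-- The characteristic function of the log-likelihood ratio up to terms of order `p³`. -/
lemma exists_norm_charFun_mixtureLogLR_sub_le (μ u : ℝ) : ∃ K : ℝ, ∀ p ∈ Icc (0 : ℝ) (1 / 2),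
    ‖charFun (mixtureLogLR μ p) u - 1
      - u * Complex.I * (u * Complex.I - 1) / 2 * (p ^ 2 * (Real.exp (μ ^ 2) - 1) : ℝ)‖
      ≤ K * p ^ 3 := by
  obtain ⟨K, hK0, hK⟩ := exists_norm_cexp_log_taylor_le u
  refine ⟨K * ∫ x, |gaussLR μ x - 1| ^ 3 ∂(gaussianReal 0 1), fun p hp => ?_⟩
  set γ := gaussianReal 0 1
  set b : ℂ := u * Complex.I
  set E : ℝ → ℂ := fun x => Complex.exp (u * Real.log (1 + p * (gaussLR μ x - 1)) * Complex.I)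
  have hEm : AEStronglyMeasurable E γ := by
    have := measurable_mixtureLogLR μ p
    exact Measurable.aestronglyMeasurable (by fun_prop)
  have hE : Integrable E γ := by
    refine (integrable_const (1 : ℝ)).mono' hEm (ae_of_all _ fun x => le_of_eq ?_)
    simp only [E, ← Complex.ofReal_mul]
    exact Complex.norm_exp_ofReal_mul_I _
  have h1 : Integrable (fun x => ((p * (gaussLR μ x - 1) : ℝ) : ℂ)) γ :=
    Integrable.ofReal ((by simpa using integrable_gaussLR_sub_one_pow μ 1 :
      Integrable (fun x => gaussLR μ x - 1) γ).const_mul p)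
  have h2 : Integrable (fun x => (((p * (gaussLR μ x - 1)) ^ 2 : ℝ) : ℂ)) γ := by
    simp_rw [mul_pow]
    exact ((integrable_gaussLR_sub_one_pow μ 2).const_mul (p ^ 2)).ofReal
  -- The first-order term vanishes because the likelihood ratio has mean `1`; the second-order one
  -- produces the χ²-divergence.
  have i1 : ∫ x, ((p * (gaussLR μ x - 1) : ℝ) : ℂ) ∂γ = 0 := by
    rw [integral_complex_ofReal, integral_const_mul, integral_sub (integrable_gaussLR μ)
      (integrable_const _), integral_gaussLR]
    simp
  have i2 : ∫ x, (((p * (gaussLR μ x - 1)) ^ 2 : ℝ) : ℂ) ∂γ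
      = (p ^ 2 * (Real.exp (μ ^ 2) - 1) : ℝ) := by
    rw [integral_complex_ofReal]
    simp_rw [mul_pow]
    rw [integral_const_mul, integral_gaussLR_sub_one_sq]
  have key : charFun (mixtureLogLR μ p) u - 1
      - b * (b - 1) / 2 * (p ^ 2 * (Real.exp (μ ^ 2) - 1) : ℝ)
      = ∫ x, (E x - 1 - b * ((p * (gaussLR μ x - 1) : ℝ) : ℂ)
        - b * (b - 1) / 2 * (((p * (gaussLR μ x - 1)) ^ 2 : ℝ) : ℂ)) ∂γ := by
    rw [integral_sub (f := fun x => E x - 1 - b * ((p * (gaussLR μ x - 1) : ℝ) : ℂ))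
        ((hE.sub (integrable_const _)).sub (h1.const_mul _)) (h2.const_mul _),
      integral_sub (f := fun x => E x - 1) (hE.sub (integrable_const _)) (h1.const_mul _),
      integral_sub hE (integrable_const _), integral_const_mul, integral_const_mul, i1, i2,
      charFun_mixtureLogLR]
    simp [γ, E]
  rw [key]
  have hdom : Integrable (fun x => K * (p ^ 3 * |gaussLR μ x - 1| ^ 3)) γ := by
    have := (integrable_gaussLR_sub_one_pow μ 3).abs
    simp_rw [abs_pow] at this
    exact (this.const_mul _).const_mul _
  refine (norm_integral_le_of_norm_le hdom (ae_of_all _ fun x => ?_)).trans (le_of_eq ?_)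
  -- Positivity of the ratio and `p ≤ 1/2` keep the argument in the range of the Taylor bound.
  · have hx : -(1 / 2) ≤ p * (gaussLR μ x - 1) := by
      have := mul_nonneg hp.1 (gaussLR_pos μ x).le
      linarith [hp.2]
    refine (le_of_eq ?_).trans ((hK _ hx).trans (le_of_eq ?_))
    · simp only [E]; push_cast; rfl
    · rw [abs_mul, abs_of_nonneg hp.1]; ring
  · rw [integral_const_mul, integral_const_mul]; ring

/-- The `k`-fold additive convolution power of a measure on `ℝ`. -/
noncomputable def convPow (ρ : Measure ℝ) : ℕ → Measure ℝ
  | 0 => Measure.dirac 0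
  | k + 1 => convPow ρ k ∗ ρ

instance convPow.isProbabilityMeasure (ρ : Measure ℝ) [IsProbabilityMeasure ρ] (k : ℕ) :
    IsProbabilityMeasure (convPow ρ k) := by
  induction k with
  | zero => exact Measure.dirac.isProbabilityMeasure
  | succ k ih => unfold convPow; infer_instance

lemma charFun_convPow (ρ : Measure ℝ) [IsProbabilityMeasure ρ] (k : ℕ) (u : ℝ) :
    charFun (convPow ρ k) u = charFun ρ u ^ k := by
  induction k with
  | zero => simp [convPow]
  | succ k ih => rw [convPow, charFun_conv, ih, pow_succ]

/-- The law of the log-likelihood ratio of `𝒩(σ, 1)` with respect to `𝒩(0, 1)`. -/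
lemma charFun_map_log_gaussLR (σ u : ℝ) :
    charFun ((gaussianReal 0 1).map fun x => σ * x - σ ^ 2 / 2) u
      = Complex.exp (u * Complex.I * (u * Complex.I - 1) / 2 * (σ ^ 2 : ℝ)) := by
  have : (gaussianReal 0 1).map (fun x => σ * x - σ ^ 2 / 2)
      = gaussianReal (-(σ ^ 2 / 2)) (NNReal.mk (σ ^ 2) (sq_nonneg σ)) := by
    rw [← Function.comp_def (fun x => x - σ ^ 2 / 2) fun x => σ * x,
      ← Measure.map_map (by fun_prop) (by fun_prop), gaussianReal_map_const_mul,
      gaussianReal_map_sub_const]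
    simp
  rw [this, charFun_gaussianReal]
  congr 1
  simp only [NNReal.coe_mk]
  push_cast
  linear_combination (-(u : ℂ) ^ 2 * σ ^ 2 / 2) * Complex.I_sq

/-- Write the characteristic function of one summand as `1 + b p² χ² + O(p³)`, with `b = iu(iu -
1)/2`. Since `t p² → c²` and `t p³ → 0`, its `t`-th power tends to `exp(b σ²)`, the characteristic
function of `𝒩(-σ²/2, σ²)`; Lévy's continuity theorem concludes. -/
theorem tendsto_integral_convPow_mixtureLogLR (μ : ℝ) {c : ℝ} {p : ℕ → ℝ}
    (hp : ∀ t, 0 ≤ p t) (hc : Tendsto (fun t : ℕ => p t * √t) atTop (𝓝 c)) {f : ℝ → ℝ}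
    (hf : Continuous f) {C : ℝ} (hfC : ∀ x, ‖f x‖ ≤ C) :
    Tendsto (fun t => ∫ y, f y ∂(convPow (mixtureLogLR μ (p t)) t)) atTop
      (𝓝 (∫ x, f ((c * √(Real.exp (μ ^ 2) - 1)) * x
        - (c * √(Real.exp (μ ^ 2) - 1)) ^ 2 / 2) ∂(gaussianReal 0 1))) := by
  set σ := c * √(Real.exp (μ ^ 2) - 1) with hσ
  have hχ : 0 ≤ Real.exp (μ ^ 2) - 1 := by linarith [Real.one_le_exp (sq_nonneg μ)]
  have hm : Measurable fun x : ℝ => σ * x - σ ^ 2 / 2 := by fun_prop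
  have hlim : IsProbabilityMeasure ((gaussianReal 0 1).map fun x => σ * x - σ ^ 2 / 2) :=
    Measure.isProbabilityMeasure_map hm.aemeasurable
  have hp0 : Tendsto p atTop (𝓝 0) := by
    have hinv : Tendsto (fun t : ℕ => (√t)⁻¹) atTop (𝓝 0) :=
      (Real.tendsto_sqrt_atTop.comp tendsto_natCast_atTop_atTop).inv_tendsto_atTop
    have := hc.mul hinv
    rw [mul_zero] at this
    refine this.congr' ?_
    filter_upwards [eventually_gt_atTop 0] with t ht
    have : (0 : ℝ) < √t := by positivity
    field_simp
  have hsq : Tendsto (fun t : ℕ => (t : ℝ) * p t ^ 2) atTop (𝓝 (c ^ 2)) := by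
    refine (hc.pow 2).congr fun t => ?_
    rw [mul_pow, Real.sq_sqrt (Nat.cast_nonneg t), mul_comm]
  let M : ℕ → ProbabilityMeasure ℝ := fun t => ⟨convPow (mixtureLogLR μ (p t)) t, inferInstance⟩
  let M₀ : ProbabilityMeasure ℝ := ⟨_, hlim⟩
  have key : Tendsto M atTop (𝓝 M₀) := by
    refine ProbabilityMeasure.tendsto_iff_tendsto_charFun.2 fun u => ?_
    simp only [M, M₀, ProbabilityMeasure.coe_mk, charFun_convPow, charFun_map_log_gaussLR]
    set b : ℂ := u * Complex.I * (u * Complex.I - 1) / 2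
    obtain ⟨K, hK⟩ := exists_norm_charFun_mixtureLogLR_sub_le μ u
    suffices h : Tendsto (fun t : ℕ => (t : ℂ) * (charFun (mixtureLogLR μ (p t)) u - 1)) atTop
        (𝓝 (b * (σ ^ 2 : ℝ))) by
      simpa using Complex.tendsto_one_add_pow_exp_of_tendsto h
    have hmain : Tendsto (fun t : ℕ => b * ((t * p t ^ 2 * (Real.exp (μ ^ 2) - 1) : ℝ) : ℂ)) atTop
        (𝓝 (b * (σ ^ 2 : ℝ))) := by
      refine Tendsto.const_mul b ((Complex.continuous_ofReal.tendsto _).comp ?_)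
      have : σ ^ 2 = c ^ 2 * (Real.exp (μ ^ 2) - 1) := by rw [hσ, mul_pow, Real.sq_sqrt hχ]
      rw [this]
      exact hsq.mul_const _
    have herr : Tendsto (fun t : ℕ => (t : ℂ) * (charFun (mixtureLogLR μ (p t)) u - 1
        - b * (p t ^ 2 * (Real.exp (μ ^ 2) - 1) : ℝ))) atTop (𝓝 0) := by
      have hb : Tendsto (fun t : ℕ => K * (t * p t ^ 2 * p t)) atTop (𝓝 0) := by
        simpa using (hsq.mul hp0).const_mul K
      refine squeeze_zero_norm' ?_ hb
      filter_upwards [hp0.eventually (ge_mem_nhds (show (0 : ℝ) < 1 / 2 by norm_num))] with t ht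
      rw [norm_mul, Complex.norm_natCast]
      calc _ ≤ (t : ℝ) * (K * p t ^ 3) := by gcongr; exact hK _ ⟨hp t, ht⟩
        _ = _ := by ring
    have := herr.add hmain
    rw [zero_add] at this
    refine this.congr fun t => ?_
    push_cast
    ring
  have := ProbabilityMeasure.tendsto_iff_forall_integral_tendsto.1 key
    (BoundedContinuousFunction.ofNormedAddCommGroup f hf C hfC)
  simp only [M, M₀, ProbabilityMeasure.coe_mk, BoundedContinuousFunction.coe_ofNormedAddCommGroup] at this
  rwa [integral_map hm.aemeasurable hf.aestronglyMeasurable] at this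

/-! ### Domination of all tests by a law of log-likelihood ratios -/

/-- Every test between `P` and `Q` has a weighted error at least that of the best test for a pair
whose log-likelihood ratio has law `ρ` under the null hypothesis. -/
def TestDominated {Y : Type*} [MeasurableSpace Y] (P Q : Measure Y) (ρ : Measure ℝ) : Prop :=
  ∀ φ : Y → ℝ, Measurable φ → (∀ y, φ y ∈ Icc (0 : ℝ) 1) → ∀ s r : ℝ, 0 ≤ s → 0 ≤ r →
    ∫ y, min (s * Real.exp y) r ∂ρ ≤ s * (1 - ∫ y, φ y ∂Q) + r * ∫ y, φ y ∂P

section Tests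

variable {Y : Type*} [MeasurableSpace Y]

lemma integrable_test {P : Measure Y} [IsFiniteMeasure P] {φ : Y → ℝ} (hφ : Measurable φ)
    (h01 : ∀ y, φ y ∈ Icc (0 : ℝ) 1) : Integrable φ P :=
  (integrable_const (1 : ℝ)).mono' hφ.aestronglyMeasurable
    (ae_of_all _ fun y => by rw [Real.norm_of_nonneg (h01 y).1]; exact (h01 y).2)

lemma integral_test_mem_Icc {P : Measure Y} [IsProbabilityMeasure P] {φ : Y → ℝ}
    (hφ : Measurable φ) (h01 : ∀ y, φ y ∈ Icc (0 : ℝ) 1) : ∫ y, φ y ∂P ∈ Icc (0 : ℝ) 1 :=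
  ⟨integral_nonneg fun y => (h01 y).1, by
    simpa using integral_mono (integrable_test hφ h01) (integrable_const (μ := P) (1 : ℝ))
      fun y => (h01 y).2⟩

lemma tradeoff_le {P Q : Measure Y} [IsProbabilityMeasure Q] {φ : Y → ℝ}
    (hφ : Measurable φ) (h01 : ∀ y, φ y ∈ Icc (0 : ℝ) 1) :
    tradeoff P Q (∫ y, φ y ∂P) ≤ 1 - ∫ y, φ y ∂Q := by
  refine csInf_le ⟨0, ?_⟩ ⟨φ, hφ, h01, rfl, rfl⟩
  rintro _ ⟨ψ, hψ, hψ01, -, rfl⟩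
  linarith [(integral_test_mem_Icc (P := Q) hψ hψ01).2]

lemma tradeoff_le_one {P Q : Measure Y} [IsProbabilityMeasure P] [IsProbabilityMeasure Q] {α : ℝ}
    (hα : α ∈ Icc (0 : ℝ) 1) : tradeoff P Q α ≤ 1 := by
  have h := tradeoff_le (P := P) (Q := Q) (φ := fun _ => α) measurable_const fun _ => hα
  simp only [integral_const, probReal_univ, smul_eq_mul, one_mul] at h
  linarith [hα.1]

lemma TestDominated.le_tradeoff {P Q : Measure Y} [IsProbabilityMeasure P] {ρ : Measure ℝ}
    (h : TestDominated P Q ρ) {α r : ℝ} (hα : α ∈ Icc (0 : ℝ) 1) (hr : 0 ≤ r) :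
    ∫ y, min (Real.exp y) r ∂ρ - r * α ≤ tradeoff P Q α := by
  refine le_csInf ⟨1 - ∫ _, α ∂Q, fun _ => α, measurable_const, fun _ => hα, by simp, rfl⟩ ?_
  rintro _ ⟨φ, hφ, h01, rfl, rfl⟩
  have := h φ hφ h01 1 r zero_le_one hr
  simp only [one_mul] at this
  linarith

/-- The log-likelihood ratio is `0`, and the weighted error is the convex combination of `s` and `r`
with weights `1 - α` and `α`. This starts the induction over steps, as the initial law is common to
both hypotheses. -/
lemma TestDominated.self (P : Measure Y) [IsProbabilityMeasure P] :
    TestDominated P P (Measure.dirac 0) := by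
  intro φ hφ h01 s r _ _
  have hα := integral_test_mem_Icc (P := P) hφ h01
  rw [integral_dirac, Real.exp_zero, mul_one]
  nlinarith [min_le_left s r, min_le_right s r, hα.1, hα.2,
    mul_le_mul_of_nonneg_right (min_le_left s r) (sub_nonneg.2 hα.2),
    mul_le_mul_of_nonneg_right (min_le_right s r) hα.1]

lemma TestDominated.map {Y' : Type*} [MeasurableSpace Y'] {P Q : Measure Y} {ρ : Measure ℝ}
    (h : TestDominated P Q ρ) {f : Y → Y'} (hf : Measurable f) :
    TestDominated (P.map f) (Q.map f) ρ := by
  intro φ hφ h01 s r hs hr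
  rw [integral_map hf.aemeasurable hφ.aestronglyMeasurable,
    integral_map hf.aemeasurable hφ.aestronglyMeasurable]
  exact h _ (hφ.comp hf) (fun y => h01 _) s r hs hr

/-- A step that contains the target with probability `w`. -/
lemma testDominated_mixture {P Q : Measure Y} [IsProbabilityMeasure P] [IsProbabilityMeasure Q]
    {μ w : ℝ} (hw : w ∈ Icc (0 : ℝ) 1)
    (h : ∀ α ∈ Icc (0 : ℝ) 1, gaussTradeoff μ α ≤ tradeoff P Q α) :
    TestDominated P (ENNReal.ofReal (1 - w) • P + ENNReal.ofReal w • Q) (mixtureLogLR μ w) := by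
  intro φ hφ h01 s r hs hr
  have hα := integral_test_mem_Icc (P := P) hφ h01
  have hg := (h _ hα).trans (tradeoff_le hφ h01)
  have hmeas := measurable_mixtureLogLR μ w
  rw [integral_add_measure ((integrable_test hφ h01).smul_measure ENNReal.ofReal_ne_top)
    ((integrable_test hφ h01).smul_measure ENNReal.ofReal_ne_top), integral_smul_measure,
    integral_smul_measure, ENNReal.toReal_ofReal (by linarith [hw.2]),
    ENNReal.toReal_ofReal hw.1, mixtureLogLR, integral_map hmeas.aemeasurable
      (Continuous.aestronglyMeasurable (by fun_prop))]
  -- The logarithm is undone where its argument is positive, which for `w = 1` rests on positivity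
  -- of the ratio itself.
  have hexp : ∀ x, Real.exp (Real.log (1 + w * (gaussLR μ x - 1))) = 1 - w + w * gaussLR μ x := by
    intro x
    have hL := gaussLR_pos μ x
    rw [Real.exp_log]
    · ring
    · rcases hw.2.lt_or_eq with hlt | rfl
      · nlinarith [mul_nonneg hw.1 hL.le]
      · linarith
  simp_rw [hexp]
  refine (integral_min_mixture_le μ hα).trans ?_
  simp only [smul_eq_mul]
  have := mul_le_mul_of_nonneg_left hg (mul_nonneg hs hw.1)
  linarith

end Tests

lemma integral_comp_kernel {Ω Y : Type*} [MeasurableSpace Ω] [MeasurableSpace Y] (P : Measure Ω)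
    [IsProbabilityMeasure P] (κ : Kernel Ω Y) [IsMarkovKernel κ] {φ : Y → ℝ} (hφ : Measurable φ)
    (h01 : ∀ y, φ y ∈ Icc (0 : ℝ) 1) :
    ∫ y, φ y ∂(P.bind κ) = ∫ ω, ∫ y, φ y ∂(κ ω) ∂P := by
  rw [← Measure.snd_compProd, Measure.snd, integral_map measurable_snd.aemeasurable
    hφ.aestronglyMeasurable, Measure.integral_compProd]
  exact integrable_test (hφ.comp measurable_snd) fun _ => h01 _

/-- Adaptive composition: log-likelihood ratios add up. -/
lemma TestDominated.bind {Ω Y : Type*} [MeasurableSpace Ω] [MeasurableSpace Y] {P Q : Measure Ω}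
    [IsProbabilityMeasure P] [IsProbabilityMeasure Q] {κ η : Kernel Ω Y} [IsMarkovKernel κ]
    [IsMarkovKernel η] {ρ ρ' : Measure ℝ} [IsProbabilityMeasure ρ] [IsProbabilityMeasure ρ']
    (h : TestDominated P Q ρ) (h' : ∀ ω, TestDominated (κ ω) (η ω) ρ') :
    TestDominated (P.bind κ) (Q.bind η) (ρ ∗ ρ') := by
  intro φ hφ h01 s r hs hr
  -- Densities with respect to the sum avoid assuming absolute continuity between `P` and `Q`.
  set ν := P + Q
  have hPν : P ≪ ν := Measure.AbsolutelyContinuous.rfl.add_right Q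
  have hQν : Q ≪ ν := Measure.absolutelyContinuous_of_le (Measure.le_add_left le_rfl)
  set p : Ω → ℝ := fun ω => (P.rnDeriv ν ω).toReal with hp
  set q : Ω → ℝ := fun ω => (Q.rnDeriv ν ω).toReal with hq
  have hpm : Measurable p := (Measure.measurable_rnDeriv P ν).ennreal_toReal
  have hqm : Measurable q := (Measure.measurable_rnDeriv Q ν).ennreal_toReal
  have hp0 : ∀ ω, 0 ≤ p ω := fun ω => ENNReal.toReal_nonneg
  have hq0 : ∀ ω, 0 ≤ q ω := fun ω => ENNReal.toReal_nonneg
  have hpi : Integrable p ν := Measure.integrable_toReal_rnDeriv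
  have hqi : Integrable q ν := Measure.integrable_toReal_rnDeriv
  have hP : ∀ f : Ω → ℝ, ∫ ω, p ω * f ω ∂ν = ∫ ω, f ω ∂P := fun f => integral_rnDeriv_smul hPν
  have hQ : ∀ f : Ω → ℝ, ∫ ω, q ω * f ω ∂ν = ∫ ω, f ω ∂Q := fun f => integral_rnDeriv_smul hQν
  -- Weighted errors of tests in terms of densities.
  have herr : ∀ (S : ℝ) (a b : Ω → ℝ), Measurable a → Measurable b →
      (∀ ω, a ω ∈ Icc (0 : ℝ) 1) → (∀ ω, b ω ∈ Icc (0 : ℝ) 1) →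
      Integrable (fun ω => S * (q ω * (1 - a ω)) + r * (p ω * b ω)) ν ∧
      S * (1 - ∫ ω, a ω ∂Q) + r * ∫ ω, b ω ∂P
        = ∫ ω, (S * (q ω * (1 - a ω)) + r * (p ω * b ω)) ∂ν := by
    intro S a b ha hb ha01 hb01
    have i1 : Integrable (fun ω => q ω * (1 - a ω)) ν :=
      hqi.mul_bdd (c := 1) (by fun_prop) (ae_of_all _ fun ω => by
        rw [Real.norm_of_nonneg (by linarith [(ha01 ω).2])]; linarith [(ha01 ω).1])
    have i2 : Integrable (fun ω => p ω * b ω) ν :=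
      hpi.mul_bdd (c := 1) (by fun_prop) (ae_of_all _ fun ω => by
        rw [Real.norm_of_nonneg (hb01 ω).1]; exact (hb01 ω).2)
    refine ⟨(i1.const_mul S).add (i2.const_mul r), ?_⟩
    rw [integral_add (i1.const_mul S) (i2.const_mul r), integral_const_mul, integral_const_mul,
      hP b, hQ fun ω => 1 - a ω, integral_sub (integrable_const _) (integrable_test ha ha01)]
    simp
  -- The hypothesis on the first stage, applied to the likelihood ratio test that rejects when `S q
  -- > r p`.
  have hfirst : ∀ S : ℝ, 0 ≤ S →
      ∫ x, min (S * Real.exp x) r ∂ρ ≤ ∫ ω, min (S * q ω) (r * p ω) ∂ν := by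
    intro S hS
    set ψ : Ω → ℝ := {ω | r * p ω < S * q ω}.indicator fun _ => 1
    have hψ : Measurable ψ := measurable_const.indicator
      (measurableSet_lt (hpm.const_mul r) (hqm.const_mul S))
    have hψ01 : ∀ ω, ψ ω ∈ Icc (0 : ℝ) 1 := fun ω => by
      by_cases hω : ω ∈ {ω | r * p ω < S * q ω} <;> simp [ψ, hω]
    refine (h ψ hψ hψ01 S r hS hr).trans (le_of_eq ?_)
    rw [(herr S ψ ψ hψ hψ hψ01 hψ01).2]
    congr 1 with ω
    by_cases hω : r * p ω < S * q ω
    · rw [min_eq_right hω.le]; simp [ψ, hω]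
    · rw [min_eq_left (not_lt.1 hω)]; simp [ψ, hω]
  set a : Ω → ℝ := fun ω => ∫ y, φ y ∂(η ω)
  set b : Ω → ℝ := fun ω => ∫ y, φ y ∂(κ ω)
  have ha : Measurable a := (hφ.stronglyMeasurable.integral_kernel (κ := η)).measurable
  have hb : Measurable b := (hφ.stronglyMeasurable.integral_kernel (κ := κ)).measurable
  have ha01 : ∀ ω, a ω ∈ Icc (0 : ℝ) 1 := fun ω => integral_test_mem_Icc hφ h01
  have hb01 : ∀ ω, b ω ∈ Icc (0 : ℝ) 1 := fun ω => integral_test_mem_Icc hφ h01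
  obtain ⟨hint, herr'⟩ := herr s a b ha hb ha01 hb01
  rw [integral_comp_kernel P κ hφ h01, integral_comp_kernel Q η hφ h01, herr']
  have hF : Integrable (fun z : Ω × ℝ => min (s * q z.1 * Real.exp z.2) (r * p z.1))
      (ν.prod ρ') := by
    refine ((hpi.const_mul r).comp_fst ρ').mono' (by fun_prop) (ae_of_all _ fun z => ?_)
    have h1 := hp0 z.1
    have h2 := hq0 z.1
    rw [Real.norm_of_nonneg (by positivity)]
    exact min_le_right _ _
  have hG : Integrable (fun z : ℝ × ℝ => min (s * Real.exp (z.1 + z.2)) r) (ρ'.prod ρ) := by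
    refine (integrable_const r).mono' (Continuous.aestronglyMeasurable (by fun_prop))
      (ae_of_all _ fun z => ?_)
    rw [Real.norm_of_nonneg (by positivity)]
    exact min_le_right _ _
  have hG' : Integrable (fun y => min (s * Real.exp y) r) (ρ' ∗ ρ) := by
    refine (integrable_const r).mono' (Continuous.aestronglyMeasurable (by fun_prop))
      (ae_of_all _ fun z => ?_)
    rw [Real.norm_of_nonneg (by positivity)]
    exact min_le_right _ _
  -- Given the second log-likelihood ratio `y`, the first stage is tested with weight `s e^y`. After
  -- Fubini, the second stage is tested at each `ω` with weights `s q(ω)` and `r p(ω)`; hence the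
  -- need for all pairs of weights in `TestDominated`.
  calc ∫ y, min (s * Real.exp y) r ∂(ρ ∗ ρ')
      = ∫ y, ∫ x, min (s * Real.exp (y + x)) r ∂ρ ∂ρ' := by
        rw [Measure.conv_comm, integral_conv hG']
    _ ≤ ∫ y, ∫ ω, min (s * q ω * Real.exp y) (r * p ω) ∂ν ∂ρ' := by
        refine integral_mono hG.integral_prod_left hF.integral_prod_right fun y => ?_
        refine le_trans (le_of_eq ?_) ((hfirst (s * Real.exp y) (by positivity)).trans
          (le_of_eq ?_))
        · congr 1 with x; rw [Real.exp_add, mul_assoc]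
        · congr 1 with ω; rw [mul_right_comm]
    _ = ∫ ω, ∫ y, min (s * q ω * Real.exp y) (r * p ω) ∂ρ' ∂ν := (integral_integral_swap hF).symm
    _ ≤ ∫ ω, (s * (q ω * (1 - a ω)) + r * (p ω * b ω)) ∂ν := by
        refine integral_mono hF.integral_prod_left hint fun ω => ?_
        refine (h' ω φ hφ h01 (s * q ω) (r * p ω) (mul_nonneg hs (hq0 ω))
          (mul_nonneg hr (hp0 ω))).trans (le_of_eq ?_)
        ring

/-! ### From log-likelihood ratios to Gaussian membership inference privacy -/

lemma integrable_min_exp (ρ : Measure ℝ) [IsProbabilityMeasure ρ] {r : ℝ} (hr : 0 ≤ r) :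
    Integrable (fun y => min (Real.exp y) r) ρ := by
  refine (integrable_const r).mono' (Continuous.aestronglyMeasurable (by fun_prop))
    (ae_of_all _ fun z => ?_)
  rw [Real.norm_of_nonneg (by positivity)]
  exact min_le_right _ _

lemma integrable_min_gaussLR (σ r : ℝ) :
    Integrable (fun x => min (gaussLR σ x) r) (gaussianReal 0 1) :=
  (integrable_gaussLR σ).inf (integrable_const r)

lemma tendsto_integral_min_gaussLR (σ : ℝ) :
    Tendsto (fun n : ℕ => ∫ x, min (gaussLR σ x) n ∂(gaussianReal 0 1)) atTop (𝓝 1) := by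
  rw [← integral_gaussLR σ]
  refine tendsto_integral_of_dominated_convergence (gaussLR σ)
    (fun n => (integrable_min_gaussLR σ n).aestronglyMeasurable) (integrable_gaussLR σ)
    (fun n => ae_of_all _ fun x => ?_) (ae_of_all _ fun x => ?_)
  · rw [Real.norm_of_nonneg (le_min (gaussLR_pos σ x).le (Nat.cast_nonneg n))]
    exact min_le_left _ _
  · obtain ⟨N, hN⟩ := exists_nat_ge (gaussLR σ x)
    refine tendsto_const_nhds.congr' ?_
    filter_upwards [eventually_ge_atTop N] with n hn
    exact (min_eq_left (hN.trans (by exact_mod_cast hn))).symm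

/-- An affine bound common to almost all targets integrates to the same bound at the mean false
positive rate, however that rate is allocated among targets. -/
lemma le_stochComp {Z Y : Type*} [MeasurableSpace Z] [MeasurableSpace Y] {𝒟 : Measure Z}
    [IsProbabilityMeasure 𝒟] {P : Measure Y} {Q : Z → Measure Y} [IsProbabilityMeasure P]
    [∀ z, IsProbabilityMeasure (Q z)] {ρ : Measure ℝ} (h : ∀ᵐ z ∂𝒟, TestDominated P (Q z) ρ)
    {α r : ℝ} (hα : α ∈ Icc (0 : ℝ) 1) (hr : 0 ≤ r) :
    ∫ y, min (Real.exp y) r ∂ρ - r * α ≤ stochComp 𝒟 (fun z => tradeoff P (Q z)) α := by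
  refine le_csInf ⟨_, fun _ => α, measurable_const, fun _ => hα, by simp, rfl⟩ ?_
  rintro _ ⟨a, ha, ha01, rfl, rfl⟩
  have hai : Integrable a 𝒟 := integrable_test ha ha01
  set B := ∫ y, min (Real.exp y) r ∂ρ
  -- Finiteness matters because `toReal` sends `∞` to `0`.
  have hfin : ∫⁻ z, ENNReal.ofReal (tradeoff P (Q z) (a z)) ∂𝒟 ≠ ∞ := by
    refine ne_top_of_le_ne_top ENNReal.one_ne_top ?_
    calc ∫⁻ z, ENNReal.ofReal (tradeoff P (Q z) (a z)) ∂𝒟 ≤ ∫⁻ _, 1 ∂𝒟 := by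
          refine lintegral_mono fun z => ?_
          simpa using ENNReal.ofReal_le_ofReal (tradeoff_le_one (P := P) (Q := Q z) (ha01 z))
      _ = 1 := by simp
  have hint : Integrable (fun z => B - r * a z) 𝒟 := (integrable_const B).sub (hai.const_mul r)
  have heq : B - r * ∫ z, a z ∂𝒟 = ∫ z, (B - r * a z) ∂𝒟 := by
    rw [integral_sub (integrable_const _) (hai.const_mul r), integral_const_mul]; simp
  rw [heq, ← ENNReal.ofReal_le_iff_le_toReal hfin]
  -- The affine bound may be negative, so it is replaced by its positive part. Staying with the
  -- lower integral avoids measurability of the trade-off value in `z`.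
  have hpos : ENNReal.ofReal (∫ z, (B - r * a z) ∂𝒟) ≤ ∫⁻ z, ENNReal.ofReal (B - r * a z) ∂𝒟 := by
    refine (ENNReal.ofReal_le_ofReal (integral_mono hint hint.pos_part
      fun z => le_max_left _ 0)).trans (le_of_eq ?_)
    rw [ofReal_integral_eq_lintegral_ofReal hint.pos_part (ae_of_all _ fun z => le_max_right _ _)]
    simp
  refine hpos.trans (lintegral_mono_ae ?_)
  filter_upwards [h] with z hz
  exact ENNReal.ofReal_le_ofReal (hz.le_tradeoff (ha01 z) hr)

lemma isMIP_gaussTradeoff_sub {Z Y : Type*} [MeasurableSpace Z] [MeasurableSpace Y]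
    {𝒟 : Measure Z} [IsProbabilityMeasure 𝒟] {P : Measure Y} {Q : Z → Measure Y}
    [IsProbabilityMeasure P] [∀ z, IsProbabilityMeasure (Q z)] {ρ : Measure ℝ}
    (h : ∀ᵐ z ∂𝒟, TestDominated P (Q z) ρ) {σ ε : ℝ} (hσ : 0 ≤ σ) (hε : 0 ≤ ε)
    (hρ : ∀ r : ℝ, 0 ≤ r →
      ∫ x, min (gaussLR σ x) r ∂(gaussianReal 0 1) - ε ≤ ∫ y, min (Real.exp y) r ∂ρ) :
    IsMIP 𝒟 P Q fun α => gaussTradeoff σ α - ε := by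
  intro α hα
  have key := fun (r : ℝ) (hr : 0 ≤ r) => (sub_le_sub_right (hρ r hr) (r * α)).trans
    (le_stochComp h hα hr)
  rcases hα.1.eq_or_lt with rfl | h0
  -- At `α = 0` the value `1` is reached only in the limit of slopes `r → ∞`.
  · have hlim := (tendsto_integral_min_gaussLR σ).sub_const ε
    have := le_of_tendsto' hlim fun n => by simpa using key n (Nat.cast_nonneg n)
    simpa [gaussTradeoff] using this
  rcases hα.2.eq_or_lt with rfl | h1
  · refine le_trans (by norm_num [gaussTradeoff]; exact hε) (Real.sInf_nonneg ?_)
    rintro _ ⟨a, -, -, -, rfl⟩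
    exact ENNReal.toReal_nonneg
  obtain ⟨r, hr, heq⟩ := exists_integral_min_eq hσ ⟨h0, h1⟩
  have := key r hr
  rw [heq] at this
  linarith

/-- Pointwise convergence of the Neyman–Pearson error curves is uniform from below. -/
lemma eventually_forall_integral_min_ge {σ : ℝ} {ρ : ℕ → Measure ℝ}
    [∀ t, IsProbabilityMeasure (ρ t)]
    (h : ∀ r : ℝ, 0 ≤ r → Tendsto (fun t => ∫ y, min (Real.exp y) r ∂(ρ t)) atTop
      (𝓝 (∫ x, min (gaussLR σ x) r ∂(gaussianReal 0 1)))) {ε : ℝ} (hε : 0 < ε) :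
    ∀ᶠ t in atTop, ∀ r : ℝ, 0 ≤ r →
      ∫ x, min (gaussLR σ x) r ∂(gaussianReal 0 1) - ε ≤ ∫ y, min (Real.exp y) r ∂(ρ t) := by
  set B : ℝ → ℝ := fun r => ∫ x, min (gaussLR σ x) r ∂(gaussianReal 0 1)
  set δ := ε / 2 with hδ
  have hδ0 : 0 < δ := by positivity
  have hBmono : Monotone B := fun r r' hrr' =>
    integral_mono (integrable_min_gaussLR σ r) (integrable_min_gaussLR σ r')
      fun x => min_le_min le_rfl hrr'
  have hBle : ∀ r, B r ≤ 1 := fun r => by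
    rw [← integral_gaussLR σ]
    exact integral_mono (integrable_min_gaussLR σ r) (integrable_gaussLR σ)
      fun x => min_le_left _ _
  have hBlip : ∀ r s, 0 ≤ s → B (r + s) ≤ B r + s := fun r s hs => by
    have : B r + s = ∫ x, (min (gaussLR σ x) r + s) ∂(gaussianReal 0 1) := by
      rw [integral_add (integrable_min_gaussLR σ r) (integrable_const s)]; simp [B]
    rw [this]
    refine integral_mono (integrable_min_gaussLR σ _)
      ((integrable_min_gaussLR σ r).add (integrable_const s)) fun x => ?_
    rw [← min_add_add_right]
    exact min_le_min (by linarith) le_rfl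
  obtain ⟨R, hR⟩ := ((tendsto_integral_min_gaussLR σ).eventually
    (lt_mem_nhds (show 1 - δ < 1 by linarith))).exists
  obtain ⟨K, hK⟩ := exists_nat_ge ((R : ℝ) / δ)
  have hKR : 1 - δ ≤ B (K * δ) := hR.le.trans (hBmono ((div_le_iff₀ hδ0).1 hK))
  -- Finitely many slopes suffice: beyond `K δ` the limit curve is within `δ` of its bound `1`, and
  -- between grid points it grows by at most `δ`. With the convergence error `δ` on the grid this
  -- totals `2δ = ε`.
  have hgrid : ∀ᶠ t in atTop, ∀ i ∈ Finset.range (K + 1),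
      B (i * δ) - δ ≤ ∫ y, min (Real.exp y) (i * δ) ∂(ρ t) := by
    rw [Filter.eventually_all_finset]
    exact fun i _ => (h (i * δ) (by positivity)).eventually (le_mem_nhds (by simpa [B] using hδ0))
  filter_upwards [hgrid] with t ht r hr
  have hmono : ∀ s, 0 ≤ s → s ≤ r →
      ∫ y, min (Real.exp y) s ∂(ρ t) ≤ ∫ y, min (Real.exp y) r ∂(ρ t) := fun s hs hsr =>
    integral_mono (integrable_min_exp _ hs) (integrable_min_exp _ hr)
      fun y => min_le_min le_rfl hsr
  rcases le_total (K * δ) r with hKr | hKr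
  · have := (ht K (by simp)).trans (hmono _ (by positivity) hKr)
    linarith [hBle r]
  · set i := ⌊r / δ⌋₊
    have hi1 : i * δ ≤ r := (le_div_iff₀ hδ0).1 (Nat.floor_le (by positivity))
    have hi2 : r ≤ i * δ + δ := by
      have := (div_lt_iff₀ hδ0).1 (Nat.lt_floor_add_one (r / δ))
      linarith
    have hiK : i ∈ Finset.range (K + 1) := by
      have : (i : ℝ) ≤ K := le_of_mul_le_mul_right (hi1.trans hKr) hδ0
      rw [Finset.mem_range]
      exact Nat.lt_succ_of_le (by exact_mod_cast this)
    have h1 := (ht i hiK).trans (hmono _ (by positivity) hi1)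
    have h2 := (hBmono hi2).trans (hBlip _ _ hδ0.le)
    linarith

/-! ### Data sets and subsampling -/

lemma map_pi_comp_injective {Z ι κ : Type*} [MeasurableSpace Z] [Fintype ι] [Fintype κ]
    (m : κ → Measure Z) [∀ i, IsProbabilityMeasure (m i)] {e : ι → κ} (he : Function.Injective e) :
    (Measure.pi m).map (fun S i => S (e i)) = Measure.pi fun i => m (e i) := by
  have h1 : iIndepFun (fun (i : κ) (S : κ → Z) => S i) (Measure.pi m) :=
    iIndepFun_pi (X := fun _ => id) fun i => aemeasurable_id
  have h2 := (iIndepFun_iff_map_fun_eq_pi_map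
    (fun i => (measurable_pi_apply (e i)).aemeasurable)).1 (h1.precomp he)
  refine h2.trans (congrArg Measure.pi (funext fun i => ?_))
  exact (measurePreserving_eval m (e i)).map_eq

/-- A given point is covered by the fraction `n / N` of the injections `Fin n ↪ Fin N`. -/
lemma card_embedding_mem_range {n N : ℕ} (x₀ : Fin N) :
    (Finset.univ.filter fun e : Fin n ↪ Fin N => ∃ j, e j = x₀).card * N
      = n * Fintype.card (Fin n ↪ Fin N) := by
  classical
  -- Transposing two points of `Fin N` shows that all points are covered equally often; counting
  -- pairs of an injection and a covered point then gives the fraction.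
  have hsymm : ∀ x : Fin N, (Finset.univ.filter fun e : Fin n ↪ Fin N => ∃ j, e j = x).card
      = (Finset.univ.filter fun e : Fin n ↪ Fin N => ∃ j, e j = x₀).card := fun x => by
    refine Finset.card_equiv (Equiv.embeddingCongr (Equiv.refl _) (Equiv.swap x x₀)) fun e => ?_
    simp only [Finset.mem_filter, Finset.mem_univ, true_and]
    refine exists_congr fun j => ?_
    change e j = x ↔ Equiv.swap x x₀ (e j) = x₀
    rw [Equiv.swap_apply_eq_iff, Equiv.swap_apply_right]
  calc _ = ∑ x : Fin N, (Finset.univ.filter fun e : Fin n ↪ Fin N => ∃ j, e j = x).card := by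
        simp [hsymm, mul_comm]
    _ = ∑ e : Fin n ↪ Fin N, (Finset.univ.filter fun x : Fin N => ∃ j, e j = x).card := by
        simp only [Finset.card_filter]
        exact Finset.sum_comm
    _ = ∑ _e : Fin n ↪ Fin N, n := by
        refine Finset.sum_congr rfl fun e _ => ?_
        have : (Finset.univ.filter fun x : Fin N => ∃ j, e j = x) = Finset.univ.map e := by
          ext x; simp
        rw [this, Finset.card_map, Finset.card_univ, Fintype.card_fin]
    _ = _ := by simp [mul_comm]

section Data

variable {Z : Type*} [MeasurableSpace Z] (𝒟 : Measure Z) [IsProbabilityMeasure 𝒟]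

instance (k : ℕ) : IsProbabilityMeasure (nullData 𝒟 k) := by
  unfold nullData; infer_instance

instance (x' : Z) (P : Prop) [Decidable P] :
    IsProbabilityMeasure (if P then Measure.dirac x' else 𝒟) := by
  split_ifs <;> infer_instance

instance (k : ℕ) (x' : Z) : IsProbabilityMeasure (memberData 𝒟 k x') := by
  unfold memberData; infer_instance

instance {n N : ℕ} [Nonempty (Fin n ↪ Fin N)] (data : Measure (Fin N → Z))
    [IsProbabilityMeasure data] : IsProbabilityMeasure (subsample n data) := by
  refine ⟨?_⟩
  have h : ∀ e : Fin n ↪ Fin N, (data.map fun S i => S (e i)) univ = 1 := fun e =>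
    (Measure.isProbabilityMeasure_map (Measurable.aemeasurable (by fun_prop))).measure_univ
  simp only [subsample, Measure.smul_apply, Measure.coe_finsetSum, Finset.sum_apply, h,
    smul_eq_mul, Finset.sum_const, nsmul_eq_mul, mul_one, Finset.card_univ]
  exact ENNReal.inv_mul_cancel (Nat.cast_ne_zero.2 Fintype.card_ne_zero)
    (ENNReal.natCast_ne_top _)

lemma map_nullData (n N : ℕ) (e : Fin n ↪ Fin N) :
    (nullData 𝒟 N).map (fun S i => S (e i)) = nullData 𝒟 n :=
  map_pi_comp_injective _ e.injective

lemma subsample_nullData {n N : ℕ} [Nonempty (Fin n ↪ Fin N)] :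
    subsample n (nullData 𝒟 N) = nullData 𝒟 n := by
  simp only [subsample, map_nullData, Finset.sum_const, Finset.card_univ]
  rw [← Nat.cast_smul_eq_nsmul ℝ≥0∞, smul_smul, ENNReal.inv_mul_cancel (Nat.cast_ne_zero.2 Fintype.card_ne_zero)
    (ENNReal.natCast_ne_top _),
    one_smul]

lemma map_memberData_of_forall_ne {n N : ℕ} (x' : Z) (e : Fin n ↪ Fin N)
    (he : ∀ j, (e j : ℕ) ≠ 0) :
    (memberData 𝒟 N x').map (fun S i => S (e i)) = nullData 𝒟 n := by
  rw [memberData, map_pi_comp_injective _ e.injective, nullData]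
  simp [he]

/-- The target lands in slot `j` of the batch, and a transposition carries it to slot `0`. This
reordering is invisible to the update, which depends on the batch only through a sum. -/
lemma map_memberData_of_eq {n N : ℕ} (x' : Z) (e : Fin n ↪ Fin N) {j : Fin n}
    (he : (e j : ℕ) = 0) (hn : 0 < n) :
    (memberData 𝒟 N x').map (fun S i => S (e i))
      = (memberData 𝒟 n x').map fun b i => b (Equiv.swap ⟨0, hn⟩ j i) := by
  rw [memberData, memberData, map_pi_comp_injective _ e.injective,
    map_pi_comp_injective _ (Equiv.swap ⟨0, hn⟩ j).injective]
  congr 1 with i : 1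
  refine if_congr ?_ rfl rfl
  have h1 : (e i : ℕ) = 0 ↔ i = j := by
    rw [← he, Fin.val_inj, e.injective.eq_iff]
  have h2 : ((Equiv.swap ⟨0, hn⟩ j i : Fin n) : ℕ) = 0 ↔ i = j := by
    rw [← Equiv.swap_apply_right (⟨0, hn⟩ : Fin n) j, ← (Equiv.swap ⟨0, hn⟩ j).injective.eq_iff,
      Equiv.swap_apply_right]
    exact (Fin.ext_iff (b := ⟨0, hn⟩)).symm
  rw [h1, h2]

end Data

/-! ### Noisy SGD -/

namespace NoisySGD

lemma measurable_clip {E : Type*} [NormedAddCommGroup E] [NormedSpace ℝ E] [MeasurableSpace E]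
    [BorelSpace E] [SecondCountableTopology E] (C : ℝ≥0∞) : Measurable (clip C : E → E) := by
  refine Measurable.ite (measurableSet_le (by fun_prop) measurable_const) measurable_id ?_
  exact (measurable_const.div measurable_norm).smul measurable_id

variable {Z : Type*} [MeasurableSpace Z] {d : ℕ} (A : NoisySGD Z d)

instance : IsProbabilityMeasure A.init := A.init_prob

instance : Nonempty (Fin A.n ↪ Fin A.N) := ⟨Fin.castLEEmb A.n_le⟩

lemma measurable_update : Measurable fun q : EuclideanSpace ℝ (Fin d) ×
    ((Fin A.n → Z) × EuclideanSpace ℝ (Fin d)) => A.update q.1 q.2.1 q.2.2 := by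
  have hgrad : ∀ i, Measurable fun q : EuclideanSpace ℝ (Fin d) ×
      ((Fin A.n → Z) × EuclideanSpace ℝ (Fin d)) => ∇ (fun w => A.loss w (q.2.1 i)) q.1 :=
    fun i => A.measurable_grad.comp (f := fun q : EuclideanSpace ℝ (Fin d) ×
      ((Fin A.n → Z) × EuclideanSpace ℝ (Fin d)) => (q.1, q.2.1 i)) (by fun_prop)
  have hsum : Measurable fun q : EuclideanSpace ℝ (Fin d) ×
      ((Fin A.n → Z) × EuclideanSpace ℝ (Fin d)) =>
        ∑ i, clip A.bound (∇ (fun w => A.loss w (q.2.1 i)) q.1) :=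
    Finset.measurable_fun_sum _ fun i _ => (measurable_clip A.bound).comp (hgrad i)
  unfold update
  fun_prop

lemma measurable_update_right (θ : EuclideanSpace ℝ (Fin d)) :
    Measurable fun p : (Fin A.n → Z) × EuclideanSpace ℝ (Fin d) => A.update θ p.1 p.2 :=
  A.measurable_update.comp measurable_prodMk_left

lemma update_comp_perm (σ : Equiv.Perm (Fin A.n)) (θ : EuclideanSpace ℝ (Fin d))
    (b : Fin A.n → Z) (ξ : EuclideanSpace ℝ (Fin d)) :
    A.update θ (fun i => b (σ i)) ξ = A.update θ b ξ := by
  unfold update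
  rw [Equiv.sum_comp σ fun i => clip A.bound (∇ (fun w => A.loss w (b i)) θ)]

lemma measurable_stepLaw (batch : Measure (Fin A.n → Z)) [IsProbabilityMeasure batch] :
    Measurable (A.stepLaw batch) := by
  have h : A.stepLaw batch = fun θ => Measure.map
      (fun q : EuclideanSpace ℝ (Fin d) × ((Fin A.n → Z) × EuclideanSpace ℝ (Fin d)) =>
        A.update q.1 q.2.1 q.2.2)
      (Measure.map (Prod.mk θ) (batch.prod (stdGaussian (EuclideanSpace ℝ (Fin d))))) := by
    funext θ
    rw [Measure.map_map A.measurable_update measurable_prodMk_left]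
    rfl
  rw [h]
  exact (Measure.measurable_map _ A.measurable_update).comp Measurable.map_prodMk_left

instance (batch : Measure (Fin A.n → Z)) [IsProbabilityMeasure batch]
    (θ : EuclideanSpace ℝ (Fin d)) : IsProbabilityMeasure (A.stepLaw batch θ) :=
  Measure.isProbabilityMeasure_map (A.measurable_update_right θ).aemeasurable

lemma stepLaw_map_perm (batch : Measure (Fin A.n → Z)) [IsProbabilityMeasure batch]
    (σ : Equiv.Perm (Fin A.n)) (θ : EuclideanSpace ℝ (Fin d)) :
    A.stepLaw (batch.map fun b i => b (σ i)) θ = A.stepLaw batch θ := by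
  have hσ : Measurable fun (b : Fin A.n → Z) i => b (σ i) := by fun_prop
  have h := Measure.map_prod_map batch (stdGaussian (EuclideanSpace ℝ (Fin d))) hσ measurable_id
  rw [Measure.map_id] at h
  rw [stepLaw, h, Measure.map_map (A.measurable_update_right θ) (hσ.prodMap measurable_id), stepLaw]
  congr 1 with p : 1
  exact A.update_comp_perm σ θ p.1 p.2

lemma stepLaw_smul_sum {ι : Type*} (s : Finset ι) (m : ι → Measure (Fin A.n → Z))
    [∀ i, IsProbabilityMeasure (m i)] (a : ℝ≥0∞) (θ : EuclideanSpace ℝ (Fin d)) :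
    A.stepLaw (a • ∑ i ∈ s, m i) θ = a • ∑ i ∈ s, A.stepLaw (m i) θ := by
  have hsum : A.stepLaw (∑ i ∈ s, m i) θ = ∑ i ∈ s, A.stepLaw (m i) θ := by
    classical
    induction s using Finset.induction_on with
    | empty => simp [stepLaw]
    | insert i s hi ih =>
      rw [Finset.sum_insert hi, Finset.sum_insert hi, ← ih, stepLaw, Measure.add_prod,
        Measure.map_add _ _ (A.measurable_update_right θ)]
      rfl
  rw [← hsum, stepLaw, Measure.prod_smul_left, Measure.map_smul]
  rfl

variable (𝒟 : Measure Z) [IsProbabilityMeasure 𝒟]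

/-- A step on a subsampled batch is the mixture of a step whose batch contains the target and a
step whose batch does not. -/
lemma stepLaw_subsample_memberData (x' : Z) (θ : EuclideanSpace ℝ (Fin d)) :
    A.stepLaw (subsample A.n (memberData 𝒟 A.N x')) θ
      = ENNReal.ofReal (1 - (A.n : ℝ) / A.N) • A.stepLaw (nullData 𝒟 A.n) θ
        + ENNReal.ofReal ((A.n : ℝ) / A.N) • A.stepLaw (memberData 𝒟 A.n x') θ := by
  classical
  have hn : 0 < A.n := A.n_pos
  have hN : 0 < A.N := hn.trans_le A.n_le
  have hprob : ∀ e : Fin A.n ↪ Fin A.N,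
      IsProbabilityMeasure ((memberData 𝒟 A.N x').map fun S i => S (e i)) := fun e =>
    Measure.isProbabilityMeasure_map (Measurable.aemeasurable (by fun_prop))
  -- The injections that select the target, which has index `0`; they form the fraction `n/N` of all
  -- injections.
  set T := Finset.univ.filter fun e : Fin A.n ↪ Fin A.N => ∃ j, e j = ⟨0, hN⟩
  set T' := Finset.univ.filter fun e : Fin A.n ↪ Fin A.N => ¬ ∃ j, e j = ⟨0, hN⟩
  set M := Fintype.card (Fin A.n ↪ Fin A.N)
  have hM : 0 < M := Fintype.card_pos
  have hcard : T.card * A.N = A.n * M := card_embedding_mem_range _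
  have hcard' : T.card + T'.card = M := Finset.card_filter_add_card_filter_not _
  have hN' : (0 : ℝ) < A.N := by exact_mod_cast hN
  have hM' : (0 : ℝ) < M := by exact_mod_cast hM
  have hT : (A.n : ℝ) / A.N = T.card / M := by
    rw [div_eq_div_iff hN'.ne' hM'.ne']; exact_mod_cast hcard.symm
  have hT' : 1 - (A.n : ℝ) / A.N = T'.card / M := by
    rw [hT, eq_div_iff hM'.ne', sub_mul, div_mul_cancel₀ _ hM'.ne', ← hcard']
    push_cast; ring
  have hof : ∀ k : ℕ, ENNReal.ofReal ((k : ℝ) / M) = (M : ℝ≥0∞)⁻¹ * k := fun k => by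
    rw [ENNReal.ofReal_div_of_pos hM', ENNReal.ofReal_natCast, ENNReal.ofReal_natCast,
      ENNReal.div_eq_inv_mul]
  have h1 : ∀ e ∈ T, A.stepLaw ((memberData 𝒟 A.N x').map fun S i => S (e i)) θ
      = A.stepLaw (memberData 𝒟 A.n x') θ := fun e he => by
    obtain ⟨j, hj⟩ := (Finset.mem_filter.1 he).2
    rw [map_memberData_of_eq 𝒟 x' e (j := j) (by rw [hj]) hn, stepLaw_map_perm]
  have h2 : ∀ e ∈ T', A.stepLaw ((memberData 𝒟 A.N x').map fun S i => S (e i)) θ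
      = A.stepLaw (nullData 𝒟 A.n) θ := fun e he => by
    rw [map_memberData_of_forall_ne 𝒟 x' e fun j hj =>
      (Finset.mem_filter.1 he).2 ⟨j, Fin.ext hj⟩]
  rw [subsample, stepLaw_smul_sum, ← Finset.sum_filter_add_sum_filter_not Finset.univ
    (fun e : Fin A.n ↪ Fin A.N => ∃ j, e j = ⟨0, hN⟩), Finset.sum_congr rfl h1,
    Finset.sum_congr rfl h2, Finset.sum_const, Finset.sum_const, hT', hT, hof, hof,
    ← Nat.cast_smul_eq_nsmul ℝ≥0∞, ← Nat.cast_smul_eq_nsmul ℝ≥0∞, smul_add, smul_smul, smul_smul,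
    add_comm]

/-- The kernel appending the next iterate. -/
noncomputable def runKernel (batch : Measure (Fin A.n → Z)) [IsProbabilityMeasure batch] (k : ℕ) :
    Kernel (Fin (k + 1) → EuclideanSpace ℝ (Fin d)) (Fin (k + 2) → EuclideanSpace ℝ (Fin d)) :=
  (Kernel.id ×ₖ (⟨A.stepLaw batch, A.measurable_stepLaw batch⟩ : Kernel _ _).comap
    (fun ω : Fin (k + 1) → EuclideanSpace ℝ (Fin d) => ω (Fin.last k))
    (measurable_pi_apply _)).map fun q => Fin.snoc q.1 q.2

lemma measurable_snoc (k : ℕ) :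
    Measurable fun q : (Fin (k + 1) → EuclideanSpace ℝ (Fin d)) × EuclideanSpace ℝ (Fin d) =>
      (Fin.snoc q.1 q.2 : Fin (k + 2) → EuclideanSpace ℝ (Fin d)) := by
  refine measurable_pi_iff.2 fun i => ?_
  refine Fin.lastCases ?_ (fun i => ?_) i
  · simpa using measurable_snd
  · simpa [Function.comp_def] using (measurable_pi_apply i).comp measurable_fst

lemma measurable_snoc_right (k : ℕ) (ω : Fin (k + 1) → EuclideanSpace ℝ (Fin d)) :
    Measurable fun θ => (Fin.snoc ω θ : Fin (k + 2) → EuclideanSpace ℝ (Fin d)) :=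
  (measurable_snoc k).comp measurable_prodMk_left

variable (batch : Measure (Fin A.n → Z)) [IsProbabilityMeasure batch]

instance : IsMarkovKernel (⟨A.stepLaw batch, A.measurable_stepLaw batch⟩ : Kernel _ _) :=
  ⟨fun θ => inferInstanceAs (IsProbabilityMeasure (A.stepLaw batch θ))⟩

instance (k : ℕ) : IsMarkovKernel (A.runKernel batch k) :=
  Kernel.IsMarkovKernel.map _ (measurable_snoc k)

lemma runKernel_apply (k : ℕ) (ω : Fin (k + 1) → EuclideanSpace ℝ (Fin d)) :
    A.runKernel batch k ω = (A.stepLaw batch (ω (Fin.last k))).map fun θ => Fin.snoc ω θ := by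
  rw [runKernel, Kernel.map_apply _ (measurable_snoc k), Kernel.prod_apply, Kernel.id_apply,
    Kernel.comap_apply, Measure.dirac_prod,
    Measure.map_map (measurable_snoc k) measurable_prodMk_left]
  rfl

lemma runLaw_succ (k : ℕ) :
    A.runLaw batch (k + 1) = (A.runLaw batch k).bind (A.runKernel batch k) := by
  rw [runLaw]
  congr 1 with ω : 1
  exact (A.runKernel_apply batch k ω).symm

instance runLaw.isProbabilityMeasure (k : ℕ) : IsProbabilityMeasure (A.runLaw batch k) := by
  induction k with
  | zero => exact Measure.isProbabilityMeasure_map (by fun_prop)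
  | succ k ih => rw [runLaw_succ]; infer_instance

/-- A run is an adaptive composition. The one-step bound is uniform in `θ`, so it applies at
whatever iterate the history has reached. -/
lemma testDominated_runLaw {batch batch' : Measure (Fin A.n → Z)} [IsProbabilityMeasure batch]
    [IsProbabilityMeasure batch'] {ρ : Measure ℝ} [IsProbabilityMeasure ρ]
    (h : ∀ θ, TestDominated (A.stepLaw batch θ) (A.stepLaw batch' θ) ρ) (k : ℕ) :
    TestDominated (A.runLaw batch k) (A.runLaw batch' k) (convPow ρ k) := by
  induction k with
  | zero => exact (TestDominated.self A.init).map (by fun_prop)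
  | succ k ih =>
    rw [runLaw_succ, runLaw_succ]
    refine ih.bind fun ω => ?_
    rw [runKernel_apply, runKernel_apply]
    exact (h _).map (measurable_snoc_right k ω)

instance (k : ℕ) : IsProbabilityMeasure (A.runNull 𝒟 k) := by
  unfold runNull; infer_instance

instance (k : ℕ) (x' : Z) : IsProbabilityMeasure (A.runMember 𝒟 k x') := by
  unfold runMember; infer_instance

instance (k : ℕ) : IsProbabilityMeasure (A.finalNull 𝒟 k) :=
  Measure.isProbabilityMeasure_map (measurable_pi_apply _).aemeasurable

instance (k : ℕ) (x' : Z) : IsProbabilityMeasure (A.finalMember 𝒟 k x') :=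
  Measure.isProbabilityMeasure_map (measurable_pi_apply _).aemeasurable

lemma div_mem_Icc : (A.n : ℝ) / A.N ∈ Icc (0 : ℝ) 1 :=
  ⟨by positivity, div_le_one_of_le₀ (by exact_mod_cast A.n_le) (Nat.cast_nonneg _)⟩

lemma IsStepGMIP.testDominated_run {A : NoisySGD Z d} {𝒟 : Measure Z} [IsProbabilityMeasure 𝒟]
    {μ : ℝ} (h : A.IsStepGMIP 𝒟 μ) (k : ℕ) :
    ∀ᵐ x' ∂𝒟, TestDominated (A.runNull 𝒟 k) (A.runMember 𝒟 k x')
      (convPow (mixtureLogLR μ ((A.n : ℝ) / A.N)) k) := by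
  filter_upwards [h] with x' hx'
  refine A.testDominated_runLaw (fun θ => ?_) k
  rw [stepLaw_subsample_memberData, subsample_nullData]
  exact testDominated_mixture A.div_mem_Icc (hx' θ)

end NoisySGD

end GMIP

theorem lemma5p3 {Z : Type*} [MeasurableSpace Z] (𝒟 : Measure Z) [IsProbabilityMeasure 𝒟]
    {d : ℕ} (A : ℕ → GMIP.NoisySGD Z d) (μstep c : ℝ) (hμ : 0 ≤ μstep)
    (hstep : ∀ t, (A t).IsStepGMIP 𝒟 μstep)
    (hc : Tendsto (fun t : ℕ => ((A t).n : ℝ) * Real.sqrt t / ((A t).N : ℝ)) atTop (𝓝 c)) :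
    let μ : ℝ := Real.sqrt 2 * c * Real.sqrt
      (Real.exp (μstep ^ 2) * GMIP.Phi (1.5 * μstep) + 3 * GMIP.Phi (-0.5 * μstep) - 2)
    GMIP.IsAsymptoticallyGMIP 𝒟 (fun t => (A t).runNull 𝒟 t) (fun t => (A t).runMember 𝒟 t) μ ∧
    GMIP.IsAsymptoticallyGMIP 𝒟 (fun t => (A t).finalNull 𝒟 t)
      (fun t => (A t).finalMember 𝒟 t) μ := by
  intro μ
  -- Nonnegativity of `c` is inherited from the sequence; it is needed to compare `σ` with `μ`.
  have hc0 : 0 ≤ c := ge_of_tendsto' hc fun t => by positivity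
  set σ := c * √(Real.exp (μstep ^ 2) - 1) with hσ
  have hσ0 : 0 ≤ σ := by positivity
  have hσμ : σ ≤ μ := by
    calc σ ≤ c * √(2 * (Real.exp (μstep ^ 2) * GMIP.Phi (1.5 * μstep)
          + 3 * GMIP.Phi (-0.5 * μstep) - 2)) := by
          rw [hσ]; gcongr; exact GMIP.exp_sq_sub_one_le hμ
      _ = μ := by rw [Real.sqrt_mul zero_le_two]; ring
  have hlim : ∀ r : ℝ, 0 ≤ r → Tendsto (fun t : ℕ => ∫ y, min (Real.exp y) r
      ∂(GMIP.convPow (GMIP.mixtureLogLR μstep (((A t).n : ℝ) / (A t).N)) t)) atTop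
      (𝓝 (∫ x, min (GMIP.gaussLR σ x) r ∂(gaussianReal 0 1))) := fun r hr =>
    GMIP.tendsto_integral_convPow_mixtureLogLR μstep (fun t => (A t).div_mem_Icc.1)
      (hc.congr fun t => by rw [mul_div_right_comm]) (f := fun y => min (Real.exp y) r)
      (by fun_prop) (C := r) fun y => by
        rw [Real.norm_of_nonneg (by positivity)]; exact min_le_right _ _
  refine ⟨fun ε hε => ?_, fun ε hε => ?_⟩
  · filter_upwards [GMIP.eventually_forall_integral_min_ge hlim hε] with t ht α hα
    exact (sub_le_sub_right (GMIP.gaussTradeoff_anti hσμ α) ε).trans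
      (GMIP.isMIP_gaussTradeoff_sub ((hstep t).testDominated_run t) hσ0 hε.le ht α hα)
  · filter_upwards [GMIP.eventually_forall_integral_min_ge hlim hε] with t ht α hα
    -- The final iterate is a post-processing of the whole sequence, so the same dominating law
    -- serves.
    have hdom : ∀ᵐ x' ∂𝒟, GMIP.TestDominated ((A t).finalNull 𝒟 t) ((A t).finalMember 𝒟 t x')
        (GMIP.convPow (GMIP.mixtureLogLR μstep (((A t).n : ℝ) / (A t).N)) t) := by
      filter_upwards [(hstep t).testDominated_run t] with x' hx'
      exact hx'.map (by fun_prop)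
    exact (sub_le_sub_right (GMIP.gaussTradeoff_anti hσμ α) ε).trans
      (GMIP.isMIP_gaussTradeoff_sub hdom hσ0 hε.le ht α hα)
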